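/- There is a universal function $\varepsilon:\mathbb{R}\to\mathbb{R}$ (not depending on any parameter) with $\varepsilon(t)=O\big((\log t)/t\big)$ as $t\to\infty$ such that the following holds. Let $1\le V\le B$ and $d$ be integers, $(N_k)_{1\le k\le B}$ positive integers, $\tau\ge 0$, and let $\Sigma\in\mathbb{R}^{d\times d}$ be a symmetric positive definite matrix with $\operatorname{Tr}\Sigma=1$. Let $s_1^2,\dots,s_B^2\ge 0$ be prescribed naive risks, with $s_k^2>0$ for $k\le V$. Consider independent bags $X^{(1)}_\bullet,\dots,X^{(B)}_\bullet$, the $k$-th one consisting of $N_k$ i.i.d. vectors of law $\mathbb{P}_k=\mathcal{N}(\mu_k,\,N_k s_k^2\Sigma)$ on $\mathbb{R}^d$. Let $\mathcal{P}_{\mathrm{single}}(\tau,V,\Sigma,s^2)$ be the set of all such models whose means $\mu_1,\dots,\mu_B\in\mathbb{R}^d$ satisfy $\|\mu_1-\mu_k\|^2\le\tau s_1^2$ for $1\le k\le V$ (and are otherwise arbitrary). For an estimator $\hat\mu_1$, i.e. a measurable function of all the samples with values in $\mathbb{R}^d$, let $R_1(\mathbb{Q},\hat\mu_1)=\mathbb{E}_{\mathbb{Q}}\|\hat\mu_1-\mu_1\|^2\in[0,\infty]$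 be its risk under $\mathbb{Q}$. Put $$\nu=\nu(\{1,\dots,V\})=\frac{1}{s_1^2}\Big(\sum_{k=1}^V \frac1{s_k^2}\Big)^{-1},\qquad \mathcal{B}(\tau,\nu)=\frac{\tau}{1+\tau}+\frac{1}{1+\tau}\cdot\frac{\nu}{1+\tau(1-\nu)},\qquad d^{\mathrm e}(\Sigma)=\frac{\operatorname{Tr}\Sigma}{\|\Sigma\|_\infty},$$ where $\|\Sigma\|_\infty$ is the Euclidean operator norm. Then $$\mathcal{B}(\tau,\nu)-\varepsilon\big(d^{\mathrm e}(\Sigma)\big)\ \le\ \inf_{\hat\mu_1}\ \sup_{\mathbb{Q}\in\mathcal{P}_{\mathrm{single}}(\tau,V,\Sigma,s^2)}\frac{R_1(\mathbb{Q},\hat\mu_1)}{s_1^2}\ \le\ \mathcal{B}(\tau,\nu),$$ the infimum being over all estimators. In particular the oracle bound $\mathcal{B}(\tau,\nu)$ is asymptotically minimax as $d^{\mathrm e}(\Sigma)\to\infty$, uniformly in all other parameters. -/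

import Mathlib

open MeasureTheory ProbabilityTheory

namespace MultiTask

noncomputable section

/-- The observation space `ℝ^d` with its Euclidean norm. -/
abbrev Obs (d : ℕ) : Type := EuclideanSpace ℝ (Fin d)

/-- The space of all samples: `B` bags, the `k`-th one consisting of `N k` vectors of `ℝ^d`. -/
abbrev Samples (B d : ℕ) (N : Fin B → ℕ) : Type := (k : Fin B) → Fin (N k) → Obs d

/-- The joint law of all samples for tasks `P`: the bags are independent and the `k`-th bag is made
of `N k` independent draws from `P k`. -/
def sampleLaw {B d : ℕ} (N : Fin B → ℕ) (P : Fin B → Measure (Obs d)) :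
    Measure (Samples B d N) :=
  Measure.pi fun k => Measure.pi fun _ : Fin (N k) => P k

/-- The mean of a task. -/
def taskMean {d : ℕ} (P : Measure (Obs d)) : Obs d := ∫ x, x ∂P

/-- The risk of `est` as an estimator of the mean of task `k`, for tasks `P`: the expected squared
Euclidean loss, with values in `[0, ∞]`. -/
def risk {B d : ℕ} (N : Fin B → ℕ) (P : Fin B → Measure (Obs d)) (k : Fin B)
    (est : Samples B d N → Obs d) : ENNReal :=
  ∫⁻ x, ‖est x - taskMean (P k)‖ₑ ^ 2 ∂(sampleLaw N P)

/-- The first `V` of the `B` tasks. -/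
def firstTasks (B V : ℕ) : Finset (Fin B) := Finset.univ.filter fun k => (k : ℕ) < V

/-- The class of families of tasks `P = (P k)` such that `P k` is Gaussian with covariance
`N k * s2 k • S` and the means of the first `V` tasks are at squared distance at most `τ * s2 0`
of the mean of the target task, which has index `0`. -/
def singleClass {B d : ℕ} [NeZero B] (N : Fin B → ℕ) (τ : ℝ) (V : ℕ)
    (S : Matrix (Fin d) (Fin d) ℝ) (s2 : Fin B → ℝ) : Set (Fin B → Measure (Obs d)) :=
  {P | ∃ μ : Fin B → Obs d,
    (∀ k, P k = multivariateGaussian (μ k) (((N k : ℝ) * s2 k) • S)) ∧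
    ∀ k ∈ firstTasks B V, ‖μ 0 - μ k‖ ^ 2 ≤ τ * s2 0}

/-- The minimax relative risk for the mean of the target task over a class of families of tasks:
the infimum runs over all (measurable) estimators. -/
def minimaxRelRisk {B d : ℕ} [NeZero B] (N : Fin B → ℕ) (s2 : Fin B → ℝ)
    (C : Set (Fin B → Measure (Obs d))) : ENNReal :=
  ⨅ (est : Samples B d N → Obs d) (_ : Measurable est),
    ⨆ P ∈ C, risk N P 0 est / ENNReal.ofReal (s2 0)

/-- The aggregated variance `s²(U) = (∑_{k ∈ U} 1 / s_k²)⁻¹` of a set of tasks. -/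
def aggVar {B : ℕ} (s2 : Fin B → ℝ) (U : Finset (Fin B)) : ℝ := (∑ k ∈ U, 1 / s2 k)⁻¹

/-- The relative aggregated variance `ν(U) = s²(U) / s_1²`. -/
def relAggVar {B : ℕ} [NeZero B] (s2 : Fin B → ℝ) (U : Finset (Fin B)) : ℝ :=
  aggVar s2 U / s2 0

/-- The oracle bound `ℬ(τ, ν)`. -/
def oracleBound (τ ν : ℝ) : ℝ :=
  τ / (1 + τ) + (1 / (1 + τ)) * (ν / (1 + τ * (1 - ν)))

/-- The effective dimension `Tr S / ‖S‖_∞`, where `‖S‖_∞` is the Euclidean operator norm. -/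
def effDim {d : ℕ} (S : Matrix (Fin d) (Fin d) ℝ) : ℝ :=
  S.trace / ‖Matrix.toEuclideanCLM (n := Fin d) (𝕜 := ℝ) S‖

end

end MultiTask

/-! Let `h` be the precision of the auxiliary tasks relative to the target (`auxPrecision`) and let
`Λ` be the operator norm of the covariance. Then `ν = 1 / (1 + h)`, and the oracle bound is `b = (1
+ h * τ) / (1 + h + h * τ)` (`oracleBound_relAggVar`).

The upper bound is attained by a weighted average of the bag means, with auxiliary weights
proportional to precision: its risk is squared bias plus variance, and one scalar is optimized
(`minimaxRelRisk_le`).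

For the lower bound, all means are put on one random line: `γ • u` for the target and `(γ + √τ) • u`
for the auxiliary tasks, in units of `√(s2 0)`, with `‖u‖ ≤ 1`. If `u` were exactly Gaussian with
the noise covariance, the Bayesian Cramér-Rao inequality (`vanTrees`) would give `γ² ≤ r (γ² + h (γ
+ √τ)² + 1)` for the relative risk `r`, and the best `γ` yields `r ≥ b` (`le_of_forall_sq_mul_le`).

Such a Gaussian `u` leaves the unit ball, but since the trace is one it concentrates near the sphere
when `Λ` is small. It is therefore replaced by its image under a smooth map into the ball whose
Jacobian is nearly the identity (`exists_almost_gaussian_map`). The map is a radial contraction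
applied separately to blocks of eigenvalues of comparable size. The cost of a block is a multiple of
its largest eigenvalue, and over dyadic blocks these costs form a geometric series of order `Λ`. The
total loss is at most `16 * Λ`, that is `16` over the effective dimension, which is smaller than the
required rate. -/

namespace MultiTask

noncomputable section

section

/-! ### Product Gaussian measures -/

/-- The standard Gaussian measure on `ι → ℝ`. -/
abbrev stdPi (ι : Type*) [Fintype ι] : Measure (ι → ℝ) := Measure.pi fun _ => gaussianReal 0 1

theorem integrable_gaussianReal_iff {g : ℝ → ℝ} :
    Integrable g (gaussianReal 0 1) ↔ Integrable fun t => gaussianPDFReal 0 1 t * g t := by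
  rw [gaussianReal_of_var_ne_zero _ one_ne_zero,
    integrable_withDensity_iff_integrable_smul' (measurable_gaussianPDF _ _)
      (ae_of_all _ fun _ => gaussianPDF_lt_top)]
  simp

theorem hasDerivAt_gaussianPDFReal (t : ℝ) :
    HasDerivAt (gaussianPDFReal 0 1) (-(t * gaussianPDFReal 0 1 t)) t := by
  have h : HasDerivAt (fun x : ℝ => -(x - 0) ^ 2 / (2 * ((1 : NNReal) : ℝ))) (-t) t := by
    have := (((hasDerivAt_id t).sub_const 0).pow 2).neg.div_const (2 * ((1 : NNReal) : ℝ))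
    convert! this using 1
    simp only [id_eq, NNReal.coe_one]
    norm_num
    ring
  have := h.exp.const_mul (Real.sqrt (2 * Real.pi * (1 : NNReal)))⁻¹
  convert! this using 1
  simp only [gaussianPDFReal]
  ring

/-- Stein's identity on the line. -/
theorem integral_deriv_gaussianReal {f f' : ℝ → ℝ} (hf : ∀ t, HasDerivAt f (f' t) t)
    (h0 : Integrable f (gaussianReal 0 1)) (h1 : Integrable f' (gaussianReal 0 1))
    (h2 : Integrable (fun t => t * f t) (gaussianReal 0 1)) :
    ∫ t, f' t ∂gaussianReal 0 1 = ∫ t, t * f t ∂gaussianReal 0 1 := by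
  -- With `φ` the Gaussian density, `φ f` has derivative `φ (f' - t f)`; both are integrable, so the
  -- derivative integrates to zero.
  have key := integral_eq_zero_of_hasDerivAt_of_integrable
    (fun t => (hasDerivAt_gaussianPDFReal t).mul (hf t))
    (((integrable_gaussianReal_iff.1 h1).sub (integrable_gaussianReal_iff.1 h2)).congr
      (ae_of_all _ fun t => by simp only [Pi.sub_apply]; ring))
    (integrable_gaussianReal_iff.1 h0)
  rw [← sub_eq_zero, ← integral_sub h1 h2,
    integral_gaussianReal_eq_integral_smul one_ne_zero]
  refine Eq.trans (integral_congr_ae (ae_of_all _ fun t => ?_)) key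
  simp only [smul_eq_mul]
  ring

variable {ι : Type*} [Fintype ι]

/-- Resampling one coordinate independently preserves the product law. This reduces Stein's identity
to the line, with the other coordinates frozen. -/
theorem measurePreserving_update [DecidableEq ι] (μ : ι → Measure ℝ)
    [∀ i, IsProbabilityMeasure (μ i)] (i : ι) :
    MeasurePreserving (fun p : (ι → ℝ) × ℝ => Function.update p.1 i p.2)
      ((Measure.pi μ).prod (μ i)) (Measure.pi μ) := by
  have hm : Measurable fun p : (ι → ℝ) × ℝ => Function.update p.1 i p.2 := by
    refine measurable_pi_lambda _ fun j => ?_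
    by_cases h : j = i
    · subst h; simpa using measurable_snd
    · simp only [Function.update_of_ne h]
      exact (measurable_pi_apply j).comp measurable_fst
  refine ⟨hm, (Measure.pi_eq fun s hs => ?_).symm⟩
  rw [Measure.map_apply hm (MeasurableSet.univ_pi hs)]
  have : (fun p : (ι → ℝ) × ℝ => Function.update p.1 i p.2) ⁻¹' Set.univ.pi s =
      (Set.univ.pi (Function.update s i Set.univ)) ×ˢ s i := by
    ext p
    simp only [Set.mem_preimage, Set.mem_pi, Set.mem_univ, true_implies, Set.mem_prod]
    constructor
    · intro h
      refine ⟨fun j => ?_, by simpa using h i⟩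
      by_cases hj : j = i
      · subst hj; simp
      · simpa [Function.update_of_ne hj] using h j
    · rintro ⟨h, h'⟩ j
      by_cases hj : j = i
      · subst hj; simpa using h'
      · simpa [Function.update_of_ne hj] using h j
  rw [this, Measure.prod_prod, Measure.pi_pi, ← Finset.mul_prod_erase _ _ (Finset.mem_univ i),
    ← Finset.mul_prod_erase (a := i) Finset.univ (fun j => μ j (s j)) (Finset.mem_univ i)]
  rw [Function.update_self, measure_univ, one_mul, mul_comm]
  congr 1
  refine Finset.prod_congr rfl fun j hj => ?_
  rw [Function.update_of_ne (Finset.ne_of_mem_erase hj)]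

/-- Stein's identity for the standard Gaussian measure on `ι → ℝ`. -/
theorem integral_deriv_stdPi [DecidableEq ι] {f f' : (ι → ℝ) → ℝ} (i : ι)
    (hf : ∀ z, HasDerivAt (fun t => f (Function.update z i t)) (f' z) (z i))
    (h0 : Integrable f (stdPi ι)) (h1 : Integrable f' (stdPi ι))
    (h2 : Integrable (fun z => z i * f z) (stdPi ι)) :
    ∫ z, f' z ∂stdPi ι = ∫ z, z i * f z ∂stdPi ι := by
  have mp := measurePreserving_update (fun _ : ι => gaussianReal 0 1) i
  have hI : ∀ g : (ι → ℝ) → ℝ, Integrable g (stdPi ι) →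
      Integrable (fun p : (ι → ℝ) × ℝ => g (Function.update p.1 i p.2))
        ((stdPi ι).prod (gaussianReal 0 1)) ∧
      ∫ z, g z ∂stdPi ι =
        ∫ z, ∫ t, g (Function.update z i t) ∂gaussianReal 0 1 ∂stdPi ι := by
    intro g hg
    have hg' := mp.integrable_comp_of_integrable hg
    refine ⟨hg', ?_⟩
    have := integral_prod _ hg'
    simp only [Function.comp_apply] at this
    rw [← this]
    conv_lhs => rw [stdPi, ← mp.map_eq]
    rw [integral_map mp.measurable.aemeasurable (by rw [mp.map_eq]; exact hg.1)]
  rw [(hI _ h1).2, (hI _ h2).2]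
  refine integral_congr_ae ?_
  filter_upwards [(hI _ h0).1.prod_right_ae, (hI _ h1).1.prod_right_ae,
    (hI _ h2).1.prod_right_ae] with z a0 a1 a2
  simp only [Function.update_self] at a2 ⊢
  refine integral_deriv_gaussianReal (fun t => ?_) a0 a1 a2
  simpa using hf (Function.update z i t)

theorem memLp_eval_stdPi (i : ι) (p : NNReal) : MemLp (fun z : ι → ℝ => z i) p (stdPi ι) :=
  (memLp_id_gaussianReal p).comp_measurePreserving
    (measurePreserving_eval (fun _ : ι => gaussianReal 0 1) i)

theorem integral_eval_stdPi (i : ι) (g : ℝ → ℝ) (hg : Measurable g) :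
    ∫ z, g (z i) ∂stdPi ι = ∫ t, g t ∂gaussianReal 0 1 := by
  have mp := measurePreserving_eval (fun _ : ι => gaussianReal 0 1) i
  rw [← mp.map_eq, integral_map mp.measurable.aemeasurable hg.aestronglyMeasurable]

theorem integral_eval_stdPi_self (i : ι) : ∫ z : ι → ℝ, z i ∂stdPi ι = 0 := by
  rw [integral_eval_stdPi i (fun t => t) measurable_id, integral_id_gaussianReal]

theorem memLp_affine_stdPi (c : ℝ) (w : ι → ℝ) :
    MemLp (fun z : ι → ℝ => c + ∑ i, w i * z i) 2 (stdPi ι) :=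
  (memLp_const c).add (memLp_finsetSum _ fun i _ => (memLp_eval_stdPi i 2).const_mul (w i))

theorem integral_linear_stdPi (w : ι → ℝ) : ∫ z, ∑ i, w i * z i ∂stdPi ι = 0 := by
  rw [integral_finsetSum _ fun i _ =>
    ((memLp_eval_stdPi i 2).const_mul (w i)).integrable (by norm_num)]
  simp [integral_const_mul, integral_eval_stdPi_self]

/-- The second moment of an affine functional of a standard Gaussian vector. -/
theorem integral_affine_sq_stdPi (c : ℝ) (w : ι → ℝ) :
    ∫ z, (c + ∑ i, w i * z i) ^ 2 ∂stdPi ι = c ^ 2 + ∑ i, w i ^ 2 := by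
  have hv : Var[fun z : ι → ℝ => c + ∑ i, w i * z i; stdPi ι] = ∑ i, w i ^ 2 := by
    rw [variance_const_add (Measurable.aestronglyMeasurable (by fun_prop))]
    have := variance_sum_pi (μ := fun _ : ι => gaussianReal 0 1) (X := fun i t => w i * t)
      (fun i => ((memLp_id_gaussianReal 2).const_mul (w i)))
    have e : (∑ i, fun z : ι → ℝ => w i * z i) = fun z => ∑ i, w i * z i := by ext; simp
    rw [e] at this
    rw [this]
    refine Finset.sum_congr rfl fun i _ => ?_
    rw [variance_const_mul, variance_fun_id_gaussianReal]
    simp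
  have hm := variance_eq_sub (memLp_affine_stdPi c w)
  have h1 : ∫ z, c + ∑ i, w i * z i ∂stdPi ι = c := by
    rw [integral_add (integrable_const _) (integrable_finsetSum _ fun i _ =>
      ((memLp_eval_stdPi i 2).const_mul (w i)).integrable (by norm_num)), integral_linear_stdPi]
    simp
  rw [hv, h1] at hm
  simp only [Pi.pow_apply] at hm
  linarith

/-! ### Translations of product Gaussian measures -/

/-- The density of the translate by `c` of the standard Gaussian measure. -/
def shiftDensity (c w : ι → ℝ) : ℝ := Real.exp (∑ i, (c i * w i - c i ^ 2 / 2))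

theorem pi_withDensity (μ : ι → Measure ℝ) [∀ i, IsProbabilityMeasure (μ i)]
    (f : ι → ℝ → ENNReal) (hf : ∀ i, Measurable (f i))
    [∀ i, SigmaFinite ((μ i).withDensity (f i))] :
    Measure.pi (fun i => (μ i).withDensity (f i)) =
      (Measure.pi μ).withDensity fun x => ∏ i, f i (x i) := by
  refine Measure.pi_eq fun s hs => ?_
  rw [withDensity_apply _ (MeasurableSet.univ_pi hs), ← lintegral_indicator (.univ_pi hs)]
  have : ∀ x : ι → ℝ, (Set.univ.pi s).indicator (fun x => ∏ i, f i (x i)) x =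
      ∏ i, (s i).indicator (f i) (x i) := by
    intro x
    by_cases hx : x ∈ Set.univ.pi s
    · rw [Set.indicator_of_mem hx]
      refine Finset.prod_congr rfl fun i _ => ?_
      rw [Set.indicator_of_mem (hx i trivial)]
    · rw [Set.indicator_of_notMem hx]
      simp only [Set.mem_pi, Set.mem_univ, true_implies, not_forall] at hx
      obtain ⟨i, hi⟩ := hx
      exact (Finset.prod_eq_zero (Finset.mem_univ i) (Set.indicator_of_notMem hi _)).symm
  simp_rw [this]
  have hind := iIndepFun_pi (μ := μ) (X := fun i => (s i).indicator (f i))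
    fun i => ((hf i).indicator (hs i)).aemeasurable
  rw [lintegral_prod_eq_prod_lintegral_of_indepFun Finset.univ _ hind
    fun i => ((hf i).indicator (hs i)).comp (measurable_pi_apply i)]
  refine Finset.prod_congr rfl fun i _ => ?_
  have mp := measurePreserving_eval μ i
  rw [withDensity_apply _ (hs i), ← lintegral_indicator (hs i)]
  exact mp.lintegral_comp ((hf i).indicator (hs i))

theorem gaussianReal_eq_withDensity (c : ℝ) :
    gaussianReal c 1 = (gaussianReal 0 1).withDensity
      fun t => ENNReal.ofReal (Real.exp (c * t - c ^ 2 / 2)) := by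
  rw [gaussianReal_of_var_ne_zero _ one_ne_zero, gaussianReal_of_var_ne_zero _ one_ne_zero,
    ← withDensity_mul _ (measurable_gaussianPDF _ _) (by fun_prop)]
  congr 1 with t
  rw [Pi.mul_apply, gaussianPDF, gaussianPDF, ← ENNReal.ofReal_mul (gaussianPDFReal_nonneg _ _ _)]
  congr 1
  rw [gaussianPDFReal, gaussianPDFReal, mul_assoc _ (Real.exp _) (Real.exp _), ← Real.exp_add]
  congr 2
  simp only [NNReal.coe_one]
  ring

/-- The Cameron-Martin formula for the standard Gaussian measure on `ι → ℝ`. -/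
theorem map_add_stdPi (c : ι → ℝ) :
    (stdPi ι).map (fun x => x + c) =
      (stdPi ι).withDensity fun w => ENNReal.ofReal (shiftDensity c w) := by
  have h1 : (stdPi ι).map (fun x => x + c) = Measure.pi fun i => gaussianReal (c i) 1 := by
    have := Measure.pi_map_pi (μ := fun _ : ι => gaussianReal 0 1) (f := fun i t => t + c i)
      (hμ := fun i => by rw [gaussianReal_map_add_const]; infer_instance)
      (fun i => by fun_prop)
    simp only [gaussianReal_map_add_const, zero_add] at this
    exact this
  have h2 : (fun i => gaussianReal (c i) 1) = fun i => (gaussianReal 0 1).withDensity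
      fun t => ENNReal.ofReal (Real.exp (c i * t - c i ^ 2 / 2)) := by
    ext1 i; exact gaussianReal_eq_withDensity _
  have : ∀ i, SigmaFinite ((gaussianReal 0 1).withDensity
      fun t => ENNReal.ofReal (Real.exp (c i * t - c i ^ 2 / 2))) := fun i => by
    rw [← gaussianReal_eq_withDensity]; infer_instance
  rw [h1, h2, pi_withDensity _ _ fun i => by fun_prop]
  congr 1 with w
  rw [shiftDensity, Real.exp_sum, ENNReal.ofReal_prod_of_nonneg fun i _ => (Real.exp_pos _).le]

end

section

/-! ### A Bayesian Cramér-Rao inequality for Gaussian shift models -/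

variable {ι κ : Type*} [Fintype ι]

theorem shiftDensity_pos (c w : ι → ℝ) : 0 < shiftDensity c w := Real.exp_pos _

@[fun_prop]
theorem measurable_shiftDensity {X : Type*} [MeasurableSpace X] {c w : X → ι → ℝ}
    (hc : Measurable c) (hw : Measurable w) : Measurable fun x => shiftDensity (c x) (w x) := by
  unfold shiftDensity
  fun_prop

/-- A smooth bounded map with bounded partial derivatives. -/
structure SmoothBounded (f : (κ → ℝ) → ℝ) (f' : κ → (κ → ℝ) → ℝ) : Prop where
  measurable : Measurable f
  measurable' : ∀ i, Measurable (f' i)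
  bounded : ∃ C, ∀ z, |f z| ≤ C
  bounded' : ∀ i, ∃ C, ∀ z, |f' i z| ≤ C
  hasDerivAt : ∀ [DecidableEq κ] i z,
    HasDerivAt (fun t => f (Function.update z i t)) (f' i z) (z i)

theorem exists_forall_abs_sum_le {X : Type*} {f : ι → X → ℝ} (h : ∀ e, ∃ C, ∀ x, |f e x| ≤ C) :
    ∃ C, ∀ x, |∑ e, f e x| ≤ C := by
  choose C hC using h
  exact ⟨∑ e, C e, fun x => (Finset.abs_sum_le_sum_abs _ _).trans
    (Finset.sum_le_sum fun e _ => hC e x)⟩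

theorem exists_forall_abs_mul_le {X : Type*} {f g : X → ℝ} (hf : ∃ C, ∀ x, |f x| ≤ C)
    (hg : ∃ C, ∀ x, |g x| ≤ C) : ∃ C, ∀ x, |f x * g x| ≤ C := by
  obtain ⟨C, hC⟩ := hf
  obtain ⟨D, hD⟩ := hg
  refine ⟨C * D, fun x => ?_⟩
  rw [abs_mul]
  exact mul_le_mul (hC x) (hD x) (abs_nonneg _) ((abs_nonneg _).trans (hC x))

theorem exists_forall_abs_sub_le {X : Type*} {f g : X → ℝ} (hf : ∃ C, ∀ x, |f x| ≤ C)
    (hg : ∃ C, ∀ x, |g x| ≤ C) : ∃ C, ∀ x, |f x - g x| ≤ C := by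
  obtain ⟨C, hC⟩ := hf
  obtain ⟨D, hD⟩ := hg
  exact ⟨C + D, fun x => (abs_sub _ _).trans (add_le_add (hC x) (hD x))⟩

theorem exists_forall_abs_const_le {X : Type*} (c : ℝ) : ∃ C, ∀ _ : X, |c| ≤ C :=
  ⟨|c|, fun _ => le_rfl⟩

section VanTrees

variable {H : ι → (κ → ℝ) → ℝ} {H' : ι → κ → (κ → ℝ) → ℝ}
  {θ : (κ → ℝ) → ℝ} {θ' : κ → (κ → ℝ) → ℝ}

/-- The derivative of the log-density of the shift model in the `i`-th parameter. -/
def shiftScore (H : ι → (κ → ℝ) → ℝ) (H' : ι → κ → (κ → ℝ) → ℝ) (i : κ) (w : ι → ℝ)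
    (z : κ → ℝ) : ℝ := ∑ e, H' e i z * (w e - H e z)

theorem hasDerivAt_shiftDensity [DecidableEq κ] (hH : ∀ e, SmoothBounded (H e) (H' e)) (i : κ)
    (w : ι → ℝ) (z : κ → ℝ) :
    HasDerivAt (fun t => shiftDensity (fun e => H e (Function.update z i t)) w)
      (shiftDensity (fun e => H e z) w * shiftScore H H' i w z) (z i) := by
  have h1 : ∀ e ∈ Finset.univ, HasDerivAt (fun t => H e (Function.update z i t) * w e -
      H e (Function.update z i t) ^ 2 / 2) (H' e i z * (w e - H e z)) (z i) := by
    intro e _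
    have := (hH e).hasDerivAt i z
    have := (this.mul_const (w e)).sub ((this.pow 2).div_const 2)
    convert! this using 1
    simp only [Function.update_eq_self]
    push_cast
    ring
  have h2 := (HasDerivAt.fun_sum h1).exp
  convert! h2 using 1
  simp [shiftDensity, shiftScore]

theorem bounded_shiftDensity (hH : ∀ e, SmoothBounded (H e) (H' e)) (w : ι → ℝ) :
    ∃ C, ∀ z, |shiftDensity (fun e => H e z) w| ≤ C := by
  have : ∃ C, ∀ z, |∑ e, (H e z * w e - H e z ^ 2 / 2)| ≤ C := by
    refine exists_forall_abs_sum_le fun e => exists_forall_abs_sub_le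
      (exists_forall_abs_mul_le (hH e).bounded (exists_forall_abs_const_le _)) ?_
    simp only [pow_two, div_eq_mul_inv]
    exact exists_forall_abs_mul_le (exists_forall_abs_mul_le (hH e).bounded (hH e).bounded)
      (exists_forall_abs_const_le _)
  obtain ⟨C, hC⟩ := this
  refine ⟨Real.exp C, fun z => ?_⟩
  rw [abs_of_pos (shiftDensity_pos _ _)]
  exact Real.exp_le_exp.2 ((le_abs_self _).trans (hC z))

theorem bounded_shiftScore (hH : ∀ e, SmoothBounded (H e) (H' e)) (i : κ) (w : ι → ℝ) :
    ∃ C, ∀ z, |shiftScore H H' i w z| ≤ C :=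
  exists_forall_abs_sum_le fun e => exists_forall_abs_mul_le ((hH e).bounded' i)
    (exists_forall_abs_sub_le (exists_forall_abs_const_le _) (hH e).bounded)

theorem measurable_shiftScore (hH : ∀ e, SmoothBounded (H e) (H' e)) (i : κ) :
    Measurable fun p : (ι → ℝ) × (κ → ℝ) => shiftScore H H' i p.1 p.2 := by
  have h1 := fun e => (hH e).measurable
  have h2 := fun e => (hH e).measurable' i
  unfold shiftScore
  fun_prop

variable [Fintype κ]

/-- Cameron-Martin on each fibre of fixed parameter. Under the reference product law the observation
and the parameter are independent, so the parameter can be integrated out at a fixed observation. -/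
theorem map_shift_prod (H : (κ → ℝ) → ι → ℝ) (hH : Measurable H) :
    ((stdPi ι).prod (stdPi κ)).map (fun p => (p.1 + H p.2, p.2)) =
      ((stdPi ι).prod (stdPi κ)).withDensity
        fun p => ENNReal.ofReal (shiftDensity (H p.2) p.1) := by
  have hm : Measurable fun p : (ι → ℝ) × (κ → ℝ) => (p.1 + H p.2, p.2) := by fun_prop
  ext s hs
  have hd : Measurable fun p : (ι → ℝ) × (κ → ℝ) =>
    ENNReal.ofReal (shiftDensity (H p.2) p.1) := by fun_prop
  rw [Measure.map_apply hm hs, Measure.prod_apply_symm (hm hs), withDensity_apply _ hs,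
    ← lintegral_indicator hs, lintegral_prod_symm' _ (hd.indicator hs)]
  refine lintegral_congr fun z => ?_
  have hz : MeasurableSet ((fun w : ι → ℝ => (w, z)) ⁻¹' s) := measurable_prodMk_right hs
  have := congrArg (fun m => m ((fun w : ι → ℝ => (w, z)) ⁻¹' s)) (map_add_stdPi (H z))
  rw [Measure.map_apply (by fun_prop) hz, withDensity_apply _ hz,
    ← lintegral_indicator hz] at this
  exact this

theorem integral_shift_prod (H : (κ → ℝ) → ι → ℝ) (hH : Measurable H)
    (g : (ι → ℝ) × (κ → ℝ) → ℝ) (hg : Measurable g) :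
    ∫ p, g (p.1 + H p.2, p.2) ∂(stdPi ι).prod (stdPi κ) =
      ∫ p, shiftDensity (H p.2) p.1 * g p ∂(stdPi ι).prod (stdPi κ) := by
  have hm : Measurable fun p : (ι → ℝ) × (κ → ℝ) => (p.1 + H p.2, p.2) := by fun_prop
  rw [← integral_map (φ := fun p : (ι → ℝ) × (κ → ℝ) => (p.1 + H p.2, p.2)) hm.aemeasurable
    hg.aestronglyMeasurable, map_shift_prod H hH,
    integral_withDensity_eq_integral_toReal_smul (by fun_prop) (by simp)]
  simp [ENNReal.toReal_ofReal (shiftDensity_pos _ _).le]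

theorem integrable_shift_prod (H : (κ → ℝ) → ι → ℝ) (hH : Measurable H)
    (g : (ι → ℝ) × (κ → ℝ) → ℝ) (hg : Measurable g) :
    Integrable (fun p => g (p.1 + H p.2, p.2)) ((stdPi ι).prod (stdPi κ)) ↔
      Integrable (fun p => shiftDensity (H p.2) p.1 * g p) ((stdPi ι).prod (stdPi κ)) := by
  have hm : Measurable fun p : (ι → ℝ) × (κ → ℝ) => (p.1 + H p.2, p.2) := by fun_prop
  have := integrable_map_measure (μ := (stdPi ι).prod (stdPi κ)) (g := g)
    (f := fun p => (p.1 + H p.2, p.2)) hg.aestronglyMeasurable hm.aemeasurable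
  rw [map_shift_prod H hH] at this
  have e := integrable_withDensity_iff_integrable_smul' (μ := (stdPi ι).prod (stdPi κ)) (g := g)
    (f := fun p => ENNReal.ofReal (shiftDensity (H p.2) p.1)) (by fun_prop) (by simp)
  refine this.symm.trans (e.trans ?_)
  simp [ENNReal.toReal_ofReal (shiftDensity_pos _ _).le]

theorem integrable_of_bounded_stdPi {f : (κ → ℝ) → ℝ} (hm : Measurable f)
    (h : ∃ C, ∀ z, |f z| ≤ C) : Integrable f (stdPi κ) := by
  obtain ⟨C, hC⟩ := h
  exact Integrable.of_bound hm.aestronglyMeasurable C (ae_of_all _ fun z => hC z)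

/-- Integration by parts in the parameter, for a fixed observation. -/
theorem integral_score_fixed_observation (hH : ∀ e, SmoothBounded (H e) (H' e))
    (hθ : SmoothBounded θ θ') (i : κ) (w : ι → ℝ) (a : ℝ) :
    ∫ z, shiftDensity (fun e => H e z) w * ((a - θ z) * (shiftScore H H' i w z - z i)) ∂stdPi κ =
      ∫ z, shiftDensity (fun e => H e z) w * θ' i z ∂stdPi κ := by
  classical
  have hHm := fun e => (hH e).measurable
  have hθm := hθ.measurable
  have hθm' := hθ.measurable' i
  have hSm : Measurable fun z => shiftScore H H' i w z :=
    (measurable_shiftScore hH i).comp measurable_prodMk_left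
  have hLm : Measurable fun z => shiftDensity (fun e => H e z) w :=
    measurable_shiftDensity (by fun_prop) (by fun_prop)
  have hLb := bounded_shiftDensity hH w
  have hab := exists_forall_abs_sub_le (exists_forall_abs_const_le a) hθ.bounded
  have hSb := bounded_shiftScore hH i w
  have hLθ : Integrable (fun z => shiftDensity (fun e => H e z) w * θ' i z) (stdPi κ) :=
    integrable_of_bounded_stdPi (by fun_prop) (exists_forall_abs_mul_le hLb (hθ.bounded' i))
  have hLS : Integrable (fun z => shiftDensity (fun e => H e z) w *
      ((a - θ z) * shiftScore H H' i w z)) (stdPi κ) :=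
    integrable_of_bounded_stdPi (by fun_prop)
      (exists_forall_abs_mul_le hLb (exists_forall_abs_mul_le hab hSb))
  have hLab := exists_forall_abs_mul_le hLb hab
  have hF : Integrable (fun z => shiftDensity (fun e => H e z) w * (a - θ z)) (stdPi κ) :=
    integrable_of_bounded_stdPi (by fun_prop) hLab
  have hzF : Integrable (fun z => z i * (shiftDensity (fun e => H e z) w * (a - θ z)))
      (stdPi κ) := by
    obtain ⟨C, hC⟩ := hLab
    exact ((memLp_eval_stdPi i 1).integrable le_rfl).mul_bdd (c := C)
      hF.1 (ae_of_all _ fun z => hC z)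
  -- At a fixed observation the estimate is a constant `a`, so Stein's identity in `z` needs no
  -- regularity of the estimator.
  have key := integral_deriv_stdPi (f := fun z => shiftDensity (fun e => H e z) w * (a - θ z))
    (f' := fun z => shiftDensity (fun e => H e z) w * ((a - θ z) * shiftScore H H' i w z) -
      shiftDensity (fun e => H e z) w * θ' i z) i (fun z => ?_) hF (hLS.sub hLθ) hzF
  · rw [integral_sub hLS hLθ] at key
    have : ∀ z, shiftDensity (fun e => H e z) w * ((a - θ z) * (shiftScore H H' i w z - z i)) =
        shiftDensity (fun e => H e z) w * ((a - θ z) * shiftScore H H' i w z) -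
          z i * (shiftDensity (fun e => H e z) w * (a - θ z)) := fun z => by ring
    simp_rw [this]
    rw [integral_sub hLS hzF, ← key]
    ring
  · have h1 := (hasDerivAt_shiftDensity hH i w z).mul ((hθ.hasDerivAt i z).const_sub a)
    convert! h1 using 1
    simp only [Function.update_eq_self]
    ring

/-- The covariance of the estimation error and the score. -/
theorem integral_error_mul_score (hH : ∀ e, SmoothBounded (H e) (H' e))
    (hθ : SmoothBounded θ θ') (i : κ) {T : (ι → ℝ) → ℝ} (hT : Measurable T)
    (hint : Integrable (fun p : (ι → ℝ) × (κ → ℝ) => (T (p.1 + fun e => H e p.2) - θ p.2) *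
      (∑ e, H' e i p.2 * p.1 e - p.2 i)) ((stdPi ι).prod (stdPi κ))) :
    ∫ p, (T (p.1 + fun e => H e p.2) - θ p.2) * (∑ e, H' e i p.2 * p.1 e - p.2 i)
      ∂(stdPi ι).prod (stdPi κ) = ∫ z, θ' i z ∂stdPi κ := by
  have hHm := fun e => (hH e).measurable
  have hθm := hθ.measurable
  have hθm' := hθ.measurable' i
  have hSm := measurable_shiftScore hH i
  have hHm' : Measurable fun z e => H e z := by fun_prop
  set g : (ι → ℝ) × (κ → ℝ) → ℝ := fun p => (T p.1 - θ p.2) * (shiftScore H H' i p.1 p.2 - p.2 i)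
    with hg
  have hgm : Measurable g := by fun_prop
  -- The noise is the observation minus `H`, so the linear form in the noise is the score evaluated
  -- at the observation.
  have e1 : ∀ p : (ι → ℝ) × (κ → ℝ), (T (p.1 + fun e => H e p.2) - θ p.2) *
      (∑ e, H' e i p.2 * p.1 e - p.2 i) = g (p.1 + (fun z e => H e z) p.2, p.2) := fun p => by
    simp [hg, shiftScore]
  simp_rw [e1] at hint ⊢
  rw [integral_shift_prod _ hHm' g hgm]
  have hint' := (integrable_shift_prod _ hHm' g hgm).1 hint
  have hθp : Measurable fun p : (ι → ℝ) × (κ → ℝ) => θ' i p.2 := by fun_prop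
  have hI2 : Integrable (fun p : (ι → ℝ) × (κ → ℝ) => θ' i p.2) ((stdPi ι).prod (stdPi κ)) := by
    obtain ⟨C, hC⟩ := hθ.bounded' i
    exact Integrable.of_bound hθp.aestronglyMeasurable C (ae_of_all _ fun z => hC z.2)
  have e2 : ∫ z, θ' i z ∂stdPi κ =
      ∫ p : (ι → ℝ) × (κ → ℝ), θ' i p.2 ∂(stdPi ι).prod (stdPi κ) := by
    rw [integral_fun_snd]; simp
  rw [e2]
  have hθs := integral_shift_prod (ι := ι) _ hHm' (fun p => θ' i p.2) hθp
  have hθI := (integrable_shift_prod (ι := ι) _ hHm' (fun p => θ' i p.2) hθp).1 hI2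
  simp only at hθs hθI
  rw [hθs, integral_prod _ hint', integral_prod _ hθI]
  exact integral_congr_ae (ae_of_all _ fun w =>
    integral_score_fixed_observation hH hθ i w (T w))

theorem memLp_score (hH : ∀ e, SmoothBounded (H e) (H' e)) (i : κ) :
    MemLp (fun p : (ι → ℝ) × (κ → ℝ) => ∑ e, H' e i p.2 * p.1 e - p.2 i) 2
      ((stdPi ι).prod (stdPi κ)) := by
  have mp2 : MeasurePreserving Prod.snd ((stdPi ι).prod (stdPi κ)) (stdPi κ) :=
    measurePreserving_snd
  have mp1 : MeasurePreserving Prod.fst ((stdPi ι).prod (stdPi κ)) (stdPi ι) :=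
    measurePreserving_fst
  refine MemLp.sub (memLp_finsetSum _ fun e _ => ?_)
    ((memLp_eval_stdPi i 2).comp_measurePreserving mp2)
  obtain ⟨C, hC⟩ := (hH e).bounded' i
  have h1 := (memLp_eval_stdPi e 2).comp_measurePreserving mp1
  refine h1.of_le_mul (c := C) (Measurable.aestronglyMeasurable ?_) (ae_of_all _ fun p => ?_)
  · have := (hH e).measurable' i
    fun_prop
  · rw [norm_mul]
    exact mul_le_mul_of_nonneg_right (hC p.2) (norm_nonneg _)

/-- The information in the `i`-th parameter. -/
theorem integral_score_sq (hH : ∀ e, SmoothBounded (H e) (H' e)) (i : κ) :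
    ∫ p : (ι → ℝ) × (κ → ℝ), (∑ e, H' e i p.2 * p.1 e - p.2 i) ^ 2 ∂(stdPi ι).prod (stdPi κ) =
      ∑ e, ∫ z, H' e i z ^ 2 ∂stdPi κ + 1 := by
  have hint := (memLp_score hH i).integrable_sq
  rw [integral_prod_symm _ hint]
  -- For fixed `z` the score is affine in the noise. Its constant part `-z i` comes from the prior
  -- and contributes the information `1`.
  have : ∀ z : κ → ℝ, ∫ w, (∑ e, H' e i z * w e - z i) ^ 2 ∂stdPi ι =
      z i ^ 2 + ∑ e, H' e i z ^ 2 := fun z => by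
    have := integral_affine_sq_stdPi (-z i) fun e => H' e i z
    rw [neg_sq] at this
    rw [← this]
    refine integral_congr_ae (ae_of_all _ fun w => ?_)
    ring
  simp_rw [this]
  have hI : ∀ e ∈ Finset.univ, Integrable (fun z => H' e i z ^ 2) (stdPi κ) := fun e _ => by
    have := (hH e).measurable' i
    refine integrable_of_bounded_stdPi (by fun_prop) ?_
    simp only [pow_two]
    exact exists_forall_abs_mul_le ((hH e).bounded' i) ((hH e).bounded' i)
  rw [integral_add (memLp_eval_stdPi i 2).integrable_sq (integrable_finsetSum _ hI),
    integral_finsetSum _ hI]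
  have h1 : ∫ z : κ → ℝ, z i ^ 2 ∂stdPi κ = 1 := by
    classical
    have := integral_affine_sq_stdPi (0 : ℝ) (Pi.single i 1 : κ → ℝ)
    simpa [Pi.single_apply, ite_pow] using this
  rw [h1, add_comm]

/-- The Bayesian Cramér-Rao (van Trees) inequality for a Gaussian shift model. -/
theorem vanTrees (hH : ∀ e, SmoothBounded (H e) (H' e)) {θ : κ → (κ → ℝ) → ℝ}
    {θ' : κ → κ → (κ → ℝ) → ℝ} (hθ : ∀ i, SmoothBounded (θ i) (θ' i)) {T : κ → (ι → ℝ) → ℝ}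
    (hT : ∀ i, Measurable (T i)) {l : κ → ℝ} (hl : ∀ i, 0 ≤ l i)
    (hint : ∀ i, MemLp (fun p : (ι → ℝ) × (κ → ℝ) => T i (p.1 + fun e => H e p.2) - θ i p.2) 2
      ((stdPi ι).prod (stdPi κ))) :
    (∑ i, l i * ∫ z, θ' i i z ∂stdPi κ) ^ 2 ≤
      (∑ i, l i * ∫ p, (T i (p.1 + fun e => H e p.2) - θ i p.2) ^ 2
        ∂(stdPi ι).prod (stdPi κ)) *
      ∑ i, l i * (∑ e, ∫ z, H' e i z ^ 2 ∂stdPi κ + 1) := by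
  set A : κ → (ι → ℝ) × (κ → ℝ) → ℝ := fun i p => T i (p.1 + fun e => H e p.2) - θ i p.2
  set W : κ → (ι → ℝ) × (κ → ℝ) → ℝ := fun i p => ∑ e, H' e i p.2 * p.1 e - p.2 i
  have hAW : ∀ i, Integrable (fun p => A i p * W i p) ((stdPi ι).prod (stdPi κ)) :=
    fun i => (hint i).integrable_mul (memLp_score hH i)
  have hN : ∀ i, ∫ z, θ' i i z ∂stdPi κ = ∫ p, A i p * W i p ∂(stdPi ι).prod (stdPi κ) :=
    fun i => (integral_error_mul_score hH (hθ i) i (hT i) (hAW i)).symm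
  simp_rw [hN, ← integral_score_sq hH]
  have hA : ∀ i, Integrable (fun p => A i p ^ 2) ((stdPi ι).prod (stdPi κ)) :=
    fun i => (hint i).integrable_sq
  have hW : ∀ i, Integrable (fun p => W i p ^ 2) ((stdPi ι).prod (stdPi κ)) :=
    fun i => (memLp_score hH i).integrable_sq
  -- This quadratic in `c` is the weighted sum of the integrals of `(A i - c * W i) ^ 2`. Its
  -- discriminant gives Cauchy-Schwarz for the sum and the integral at once.
  have key : ∀ c : ℝ, 0 ≤ (∑ i, l i * ∫ p, W i p ^ 2 ∂(stdPi ι).prod (stdPi κ)) * (c * c) +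
      (-2 * ∑ i, l i * ∫ p, A i p * W i p ∂(stdPi ι).prod (stdPi κ)) * c +
      ∑ i, l i * ∫ p, A i p ^ 2 ∂(stdPi ι).prod (stdPi κ) := by
    intro c
    have h : ∀ i, 0 ≤ ∫ p, A i p ^ 2 ∂(stdPi ι).prod (stdPi κ) -
        2 * c * ∫ p, A i p * W i p ∂(stdPi ι).prod (stdPi κ) +
        c ^ 2 * ∫ p, W i p ^ 2 ∂(stdPi ι).prod (stdPi κ) := by
      intro i
      have hs : Integrable (fun p => A i p ^ 2 - 2 * c * (A i p * W i p))
          ((stdPi ι).prod (stdPi κ)) := (hA i).sub ((hAW i).const_mul _)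
      rw [← integral_const_mul, ← integral_const_mul,
        ← integral_sub (hA i) ((hAW i).const_mul _), ← integral_add hs ((hW i).const_mul _)]
      refine integral_nonneg fun p => ?_
      have := sq_nonneg (A i p - c * W i p)
      simp only [Pi.zero_apply]
      linarith
    have h' := Finset.sum_nonneg fun i (_ : i ∈ Finset.univ) => mul_nonneg (hl i) (h i)
    simp only [mul_add, mul_sub, Finset.sum_add_distrib, Finset.sum_sub_distrib] at h'
    refine h'.trans (le_of_eq ?_)
    simp only [Finset.mul_sum, Finset.sum_mul, ← Finset.sum_sub_distrib, ← Finset.sum_add_distrib]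
    refine Finset.sum_congr rfl fun i _ => ?_
    ring
  have := discrim_le_zero key
  rw [discrim] at this
  linarith

end VanTrees

end

section

/-! ### A prior on a ball which is almost Gaussian -/

theorem integrable_sq_gaussianReal : Integrable (fun t : ℝ => t ^ 2) (gaussianReal 0 1) :=
  (memLp_id_gaussianReal 2).integrable_sq

theorem integral_sq_gaussianReal : ∫ t, t ^ 2 ∂gaussianReal 0 1 = 1 := by
  have h := variance_eq_sub (memLp_id_gaussianReal (μ := 0) (v := 1) 2)
  rw [variance_id_gaussianReal] at h
  simpa [integral_id_gaussianReal] using h.symm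

theorem integrable_pow_gaussianReal (n : ℕ) :
    Integrable (fun t : ℝ => t ^ n) (gaussianReal 0 1) := by
  rcases Nat.eq_zero_or_pos n with rfl | hn
  · simp
  have h := (memLp_id_gaussianReal (μ := 0) (v := 1) n).integrable_norm_pow hn.ne'
  refine h.mono' (by fun_prop) (ae_of_all _ fun t => ?_)
  simp

theorem integral_pow_four_gaussianReal : ∫ t, t ^ 4 ∂gaussianReal 0 1 = 3 := by
  have h := integral_deriv_gaussianReal (f := fun t => t ^ 3) (f' := fun t => 3 * t ^ 2)
    (fun t => by simpa using hasDerivAt_pow 3 t) (integrable_pow_gaussianReal 3)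
    (integrable_sq_gaussianReal.const_mul 3)
    ((integrable_pow_gaussianReal 4).congr (ae_of_all _ fun t => by ring))
  rw [integral_const_mul, integral_sq_gaussianReal] at h
  rw [show (3 : ℝ) = 3 * 1 by norm_num, h]
  exact integral_congr_ae (ae_of_all _ fun t => by ring)

theorem variance_sq_gaussianReal : Var[fun t => t ^ 2; gaussianReal 0 1] = 2 := by
  have hm : MemLp (fun t : ℝ => t ^ 2) 2 (gaussianReal 0 1) := by
    rw [memLp_two_iff_integrable_sq (by fun_prop)]
    exact (integrable_pow_gaussianReal 4).congr (ae_of_all _ fun t => by ring)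
  rw [variance_eq_sub hm, integral_sq_gaussianReal]
  have : ∫ t, ((fun t : ℝ => t ^ 2) ^ 2) t ∂gaussianReal 0 1 = 3 := by
    rw [← integral_pow_four_gaussianReal]
    exact integral_congr_ae (ae_of_all _ fun t => by simp only [Pi.pow_apply]; ring)
  rw [this]
  norm_num

variable {κ : Type*}

/-- The total weight of a block. -/
def blockWeight (l : κ → ℝ) (s : Finset κ) : ℝ := ∑ j ∈ s, l j

/-- The normalized weighted squared norm of a block of coordinates. -/
def blockNormSq (l : κ → ℝ) (s : Finset κ) (z : κ → ℝ) : ℝ :=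
  (∑ j ∈ s, l j * z j ^ 2) / blockWeight l s

/-- A smooth map which brings a block of coordinates to normalized weighted norm at most one, and
is almost the identity where this norm is close to one. -/
def blockMap (l : κ → ℝ) (s : Finset κ) (i : κ) (z : κ → ℝ) : ℝ :=
  2 * z i / (1 + blockNormSq l s z)

/-- The partial derivatives of `blockMap`. -/
def blockMapDeriv [DecidableEq κ] (l : κ → ℝ) (s : Finset κ) (i j : κ) (z : κ → ℝ) : ℝ :=
  if j ∈ s then 2 / (1 + blockNormSq l s z) * ((if i = j then 1 else 0) -
    2 * l j * z i * z j / (blockWeight l s * (1 + blockNormSq l s z))) else 0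

theorem integrable_blockNormSq [Fintype κ] {l : κ → ℝ} {s : Finset κ} :
    Integrable (blockNormSq l s) (stdPi κ) := by
  refine Integrable.div_const (integrable_finsetSum _ fun i _ => ?_) _
  exact (memLp_eval_stdPi i 2).integrable_sq.const_mul _

theorem memLp_blockNormSq [Fintype κ] {l : κ → ℝ} {s : Finset κ} : MemLp (blockNormSq l s) 2 (stdPi κ) := by
  have : ∀ i : κ, MemLp (fun z : κ → ℝ => z i ^ 2) 2 (stdPi κ) := fun i => by
    have hm : MemLp (fun t : ℝ => t ^ 2) 2 (gaussianReal 0 1) := by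
      rw [memLp_two_iff_integrable_sq (by fun_prop)]
      exact (integrable_pow_gaussianReal 4).congr (ae_of_all _ fun t => by ring)
    exact hm.comp_measurePreserving (measurePreserving_eval (fun _ : κ => gaussianReal 0 1) i)
  unfold blockNormSq
  simp_rw [div_eq_inv_mul]
  exact (memLp_finsetSum _ fun i _ => (this i).const_mul _).const_mul _

/-! ### The radial contraction of one block: range, derivatives and their Gaussian averages -/

section Block

variable {l : κ → ℝ} {s : Finset κ} (hl : ∀ i, 0 < l i)

include hl

theorem blockWeight_nonneg : 0 ≤ blockWeight l s := Finset.sum_nonneg fun i _ => (hl i).le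

theorem blockWeight_pos {i : κ} (hi : i ∈ s) : 0 < blockWeight l s :=
  Finset.sum_pos (fun i _ => hl i) ⟨i, hi⟩

theorem blockNormSq_nonneg (z : κ → ℝ) : 0 ≤ blockNormSq l s z :=
  div_nonneg (Finset.sum_nonneg fun i _ => mul_nonneg (hl i).le (sq_nonneg _))
    (blockWeight_nonneg hl)

theorem sum_mul_sq_eq (z : κ → ℝ) :
    ∑ j ∈ s, l j * z j ^ 2 = blockWeight l s * blockNormSq l s z := by
  rcases s.eq_empty_or_nonempty with rfl | ⟨i, hi⟩
  · simp [blockWeight]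
  · rw [blockNormSq, mul_div_cancel₀ _ (blockWeight_pos hl hi).ne']

theorem mul_sq_le {i : κ} (hi : i ∈ s) (z : κ → ℝ) :
    l i * z i ^ 2 ≤ blockWeight l s * blockNormSq l s z := by
  rw [← sum_mul_sq_eq hl]
  exact Finset.single_le_sum (f := fun j => l j * z j ^ 2)
    (fun j _ => mul_nonneg (hl j).le (sq_nonneg _)) hi

/-- With `x = blockNormSq l s z`, the contraction turns `x` into `4 x / (1 + x) ^ 2`, which is at
most one because `(1 - x) ^ 2 ≥ 0`. -/
theorem sum_mul_blockMap_sq_le (z : κ → ℝ) :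
    ∑ i ∈ s, l i * blockMap l s i z ^ 2 ≤ blockWeight l s := by
  have hx := blockNormSq_nonneg (s := s) hl z
  have h1 : ∀ i ∈ s, l i * blockMap l s i z ^ 2 =
      4 / (1 + blockNormSq l s z) ^ 2 * (l i * z i ^ 2) := fun i _ => by
    rw [blockMap]; field_simp; ring
  rw [Finset.sum_congr rfl h1, ← Finset.mul_sum, sum_mul_sq_eq hl, div_mul_eq_mul_div,
    div_le_iff₀ (by positivity)]
  have := mul_nonneg (blockWeight_nonneg (s := s) hl) (sq_nonneg (1 - blockNormSq l s z))
  linarith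

theorem hasDerivAt_blockMap [DecidableEq κ] {i : κ} (hi : i ∈ s) (j : κ) (z : κ → ℝ) :
    HasDerivAt (fun t => blockMap l s i (Function.update z j t)) (blockMapDeriv l s i j z)
      (z j) := by
  have hx := blockNormSq_nonneg (s := s) hl z
  have hT := blockWeight_pos hl hi
  have hz : ∀ k, HasDerivAt (fun t => Function.update z j t k) (if k = j then 1 else 0) (z j) := by
    intro k
    by_cases h : k = j
    · subst h; simpa using hasDerivAt_id' (z k)
    · simpa [Function.update_of_ne h, h] using hasDerivAt_const (z j) (z k)
  have hN : HasDerivAt (fun t => blockNormSq l s (Function.update z j t))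
      (if j ∈ s then 2 * l j * z j / blockWeight l s else 0) (z j) := by
    have h1 : ∀ k ∈ s, HasDerivAt (fun t => l k * Function.update z j t k ^ 2)
        (if k = j then 2 * l j * z j else 0) (z j) := by
      intro k _
      have := ((hz k).pow 2).const_mul (l k)
      convert! this using 1
      by_cases h : k = j
      · subst h; simp; ring
      · simp [h]
    have h2 := (HasDerivAt.fun_sum h1).div_const (blockWeight l s)
    convert! h2 using 1
    simp only [Finset.sum_ite_eq', ite_div, zero_div]
  have h := ((hz i).const_mul 2).div (hN.const_add 1) (by simp; positivity)
  convert! h using 1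
  simp only [Function.update_eq_self, blockMapDeriv]
  by_cases hj : j ∈ s
  · simp only [hj, if_true]
    field_simp
  · have hij : i ≠ j := fun h => hj (h ▸ hi)
    simp [hj, hij]

theorem smoothBounded_blockMap [DecidableEq κ] {i : κ} (hi : i ∈ s) :
    SmoothBounded (blockMap l s i) (blockMapDeriv l s i) where
  measurable := by unfold blockMap blockNormSq; fun_prop
  measurable' j := by
    unfold blockMapDeriv blockNormSq
    split_ifs <;> fun_prop
  hasDerivAt {inst} j z := by
    convert! hasDerivAt_blockMap hl hi j z
  bounded := by
    -- Since `a ≤ (1 + a) ^ 2` for `a ≥ 0`, the bound `1 + a` serves in place of `√a`.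
    refine ⟨1 + blockWeight l s / l i, fun z => abs_le_of_sq_le_sq ?_ ?_⟩
    · have hli := hl i
      have h1 := (Finset.single_le_sum (f := fun j => l j * blockMap l s j z ^ 2)
        (fun j _ => mul_nonneg (hl j).le (sq_nonneg _)) hi).trans (sum_mul_blockMap_sq_le hl z)
      have h2 : blockMap l s i z ^ 2 ≤ blockWeight l s / l i := by
        rw [le_div_iff₀ hli]; linarith
      have h3 : 0 ≤ blockWeight l s / l i := div_nonneg (blockWeight_nonneg hl) hli.le
      nlinarith
    · have := div_nonneg (blockWeight_nonneg (s := s) hl) (hl i).le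
      linarith
  bounded' j := by
    by_cases hj : j ∈ s
    swap
    · exact ⟨0, fun z => by simp [blockMapDeriv, hj]⟩
    refine ⟨2 * (1 + l j * (1 / l i + 1 / l j)), fun z => ?_⟩
    have hx := blockNormSq_nonneg (s := s) hl z
    have hT := blockWeight_pos hl hi
    have hli := hl i
    have hlj := hl j
    have hzi : z i ^ 2 ≤ blockWeight l s * blockNormSq l s z * (1 / l i) := by
      rw [mul_one_div, le_div_iff₀ hli, mul_comm]; exact mul_sq_le hl hi z
    have hzj : z j ^ 2 ≤ blockWeight l s * blockNormSq l s z * (1 / l j) := by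
      rw [mul_one_div, le_div_iff₀ hlj, mul_comm]; exact mul_sq_le hl hj z
    have h1 : |2 * l j * z i * z j / (blockWeight l s * (1 + blockNormSq l s z))| ≤
        l j * (1 / l i + 1 / l j) := by
      rw [abs_div, abs_of_pos (a := blockWeight l s * (1 + blockNormSq l s z)) (by positivity),
        div_le_iff₀ (by positivity), show 2 * l j * z i * z j = l j * (2 * (z i * z j)) by ring,
        abs_mul, abs_of_pos hlj, mul_assoc]
      refine mul_le_mul_of_nonneg_left ?_ hlj.le
      have h2 : |2 * (z i * z j)| ≤ z i ^ 2 + z j ^ 2 :=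
        abs_le.2 ⟨by nlinarith [sq_nonneg (z i + z j)], by nlinarith [sq_nonneg (z i - z j)]⟩
      have h3 : 0 ≤ (1 / l i + 1 / l j) * blockWeight l s := by positivity
      nlinarith
    have h2 : |(if i = j then (1 : ℝ) else 0)| ≤ 1 := by split_ifs <;> simp
    simp only [blockMapDeriv, hj, if_true]
    rw [abs_mul]
    refine mul_le_mul ?_ ((abs_sub _ _).trans (add_le_add h2 h1)) (abs_nonneg _) (by norm_num)
    rw [abs_of_nonneg (by positivity), div_le_iff₀ (by positivity)]
    linarith

/-- The convex function `2 / (1 + x)` lies above its tangent at `x = 1`, whose slope term has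
Gaussian mean zero. The rank-one part of the Jacobian costs at most `c`, because `4 x / (1 + x) ^ 2
≤ 1`. -/
theorem sum_blockMapDeriv_self_ge [DecidableEq κ] {c : ℝ} (hc0 : 0 ≤ c)
    (hc : ∀ i ∈ s, l i ≤ c) (z : κ → ℝ) :
    blockWeight l s * (1 - (blockNormSq l s z - 1) / 2) - c ≤
      ∑ i ∈ s, l i * blockMapDeriv l s i i z := by
  rcases s.eq_empty_or_nonempty with rfl | ⟨i₀, hi₀⟩
  · simp [blockWeight, hc0]
  have hx := blockNormSq_nonneg (s := s) hl z
  have hT := blockWeight_pos hl hi₀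
  set x := blockNormSq l s z with hxdef
  set T := blockWeight l s with hTdef
  have h1 : ∀ i ∈ s, 2 / (1 + x) * l i - 4 / (T * (1 + x) ^ 2) * (c * (l i * z i ^ 2)) ≤
      l i * blockMapDeriv l s i i z := by
    intro i hi
    have e : l i * blockMapDeriv l s i i z =
        2 / (1 + x) * l i - 4 / (T * (1 + x) ^ 2) * (l i * (l i * z i ^ 2)) := by
      simp only [blockMapDeriv, hi, if_true, ← hxdef, ← hTdef]
      field_simp
      ring
    rw [e]
    refine sub_le_sub_left (mul_le_mul_of_nonneg_left (mul_le_mul_of_nonneg_right (hc i hi) ?_)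
      (by positivity)) _
    exact mul_nonneg (hl i).le (sq_nonneg _)
  refine le_trans ?_ (Finset.sum_le_sum h1)
  rw [Finset.sum_sub_distrib, ← Finset.mul_sum, ← Finset.mul_sum, ← Finset.mul_sum,
    sum_mul_sq_eq hl]
  change _ ≤ 2 / (1 + x) * T - 4 / (T * (1 + x) ^ 2) * (c * (T * x))
  have h2 : 1 - (x - 1) / 2 ≤ 2 / (1 + x) := by
    rw [le_div_iff₀ (by positivity)]; nlinarith [sq_nonneg (x - 1)]
  have h3 : 4 / (T * (1 + x) ^ 2) * (c * (T * x)) ≤ c := by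
    rw [div_mul_eq_mul_div, div_le_iff₀ (by positivity)]
    have := mul_nonneg (mul_nonneg hc0 hT.le) (sq_nonneg (1 - x))
    linarith
  nlinarith [mul_le_mul_of_nonneg_left h2 hT.le]

/-- The main factor `4 / (1 + x) ^ 2` is bounded by its first-order expansion at `x = 1` plus a
quadratic remainder. In the square of the rank-one perturbation the cross term is negative and is
dropped. The remaining term contains the unweighted sum `Z` of squares; it is controlled by the
weighted one because all weights of the block lie between `c / 2` and `c`. This is why the blocks
are dyadic. -/
theorem sum_blockMapDeriv_sq_le [DecidableEq κ] {c : ℝ} (hc0 : 0 < c) (hc : ∀ i ∈ s, l i ≤ c)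
    (hc' : ∀ i ∈ s, c ≤ 2 * l i) (z : κ → ℝ) :
    ∑ i ∈ s, l i * ∑ j ∈ s, blockMapDeriv l s j i z ^ 2 ≤
      blockWeight l s * (1 - (blockNormSq l s z - 1) + 2 * (blockNormSq l s z - 1) ^ 2) +
        2 * c := by
  rcases s.eq_empty_or_nonempty with rfl | ⟨i₀, hi₀⟩
  · simp [blockWeight]; exact hc0.le
  have hx := blockNormSq_nonneg (s := s) hl z
  have hT := blockWeight_pos hl hi₀
  have hsum := sum_mul_sq_eq (s := s) hl z
  set x := blockNormSq l s z with hxdef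
  set T := blockWeight l s with hTdef
  set Z := ∑ j ∈ s, z j ^ 2 with hZ
  have hZ0 : 0 ≤ Z := Finset.sum_nonneg fun i _ => sq_nonneg _
  set u := 1 / (1 + x) with hu
  have hu0 : 0 < u := by positivity
  have hZle : c * Z ≤ 2 * (T * x) := by
    rw [← hsum, hZ, Finset.mul_sum, Finset.mul_sum]
    refine Finset.sum_le_sum fun i hi => ?_
    nlinarith [mul_le_mul_of_nonneg_right (hc' i hi) (sq_nonneg (z i))]
  have h1 : ∀ i ∈ s, l i * ∑ j ∈ s, blockMapDeriv l s j i z ^ 2 ≤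
      4 * u ^ 2 * l i + 16 * u ^ 4 * Z / T ^ 2 * c ^ 2 * (l i * z i ^ 2) := by
    intro i hi
    have e : ∀ j ∈ s, blockMapDeriv l s j i z ^ 2 =
        (if j = i then 4 * u ^ 2 * (1 - 4 * l i * z i ^ 2 * u / T) else 0) +
          16 * u ^ 4 * l i ^ 2 * z i ^ 2 / T ^ 2 * z j ^ 2 := by
      intro j _
      simp only [blockMapDeriv, hi, if_true, ← hxdef, ← hTdef, hu]
      split_ifs with h
      · subst h; field_simp; ring
      · field_simp; ring
    rw [Finset.sum_congr rfl e, Finset.sum_add_distrib, Finset.sum_ite_eq' s i, if_pos hi,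
      ← Finset.mul_sum, ← hZ]
    have hli := hl i
    have e1 : 0 ≤ 4 * u ^ 2 * (4 * l i * z i ^ 2 * u / T) * l i := by positivity
    have e2 : l i ^ 2 ≤ c ^ 2 := pow_le_pow_left₀ hli.le (hc i hi) 2
    have e3 : 16 * u ^ 4 * Z / T ^ 2 * l i ^ 2 * (l i * z i ^ 2) ≤
        16 * u ^ 4 * Z / T ^ 2 * c ^ 2 * (l i * z i ^ 2) := by gcongr
    have e4 : l i * (16 * u ^ 4 * l i ^ 2 * z i ^ 2 / T ^ 2 * Z) =
      16 * u ^ 4 * Z / T ^ 2 * l i ^ 2 * (l i * z i ^ 2) := by ring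
    rw [mul_add, e4]
    nlinarith
  refine (Finset.sum_le_sum h1).trans ?_
  rw [Finset.sum_add_distrib, ← Finset.mul_sum, ← Finset.mul_sum, hsum]
  change 4 * u ^ 2 * T + _ ≤ _
  have h2 : 4 * u ^ 2 ≤ 1 - (x - 1) + 2 * (x - 1) ^ 2 := by
    rw [hu, div_pow, mul_div_assoc', div_le_iff₀ (by positivity)]
    nlinarith [mul_nonneg hx (sq_nonneg (x - 1)), mul_nonneg (mul_nonneg hx hx) (sq_nonneg (x - 1)),
      sq_nonneg (x - 1)]
  have h3 : 16 * u ^ 4 * Z / T ^ 2 * c ^ 2 * (T * x) ≤ 2 * c := by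
    have e1 : 16 * u ^ 4 * Z / T ^ 2 * c ^ 2 * (T * x) = 16 * u ^ 4 / T * c * x * (c * Z) := by
      field_simp
    have e2 : 16 * u ^ 4 / T * c * x * (c * Z) ≤ 16 * u ^ 4 / T * c * x * (2 * (T * x)) := by
      gcongr
    have e3 : 16 * u ^ 4 / T * c * x * (2 * (T * x)) = 2 * c * (4 * (x * u ^ 2)) ^ 2 := by
      field_simp; ring
    have e4 : 4 * (x * u ^ 2) ≤ 1 := by
      rw [hu, div_pow, mul_div_assoc', mul_div_assoc', div_le_one (by positivity)]
      nlinarith [sq_nonneg (x - 1)]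
    have e5 : (4 * (x * u ^ 2)) ^ 2 ≤ 1 := pow_le_one₀ (by positivity) e4
    rw [e1]
    nlinarith
  nlinarith [mul_le_mul_of_nonneg_left h2 hT.le]

variable [Fintype κ]

theorem integral_blockNormSq {i : κ} (hi : i ∈ s) : ∫ z, blockNormSq l s z ∂stdPi κ = 1 := by
  unfold blockNormSq
  rw [integral_div, integral_finsetSum _ fun i _ =>
    (memLp_eval_stdPi i 2).integrable_sq.const_mul _]
  have : ∀ i : κ, ∫ z, l i * z i ^ 2 ∂stdPi κ = l i := fun i => by
    rw [integral_const_mul, integral_eval_stdPi i (fun t => t ^ 2) (by fun_prop),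
      integral_sq_gaussianReal, mul_one]
  simp_rw [this]
  exact div_self (blockWeight_pos hl hi).ne'

/-- The integral is the variance of `∑ a i * z i ^ 2` with `a i = l i / blockWeight l s`, namely `2
* ∑ a i ^ 2`. As the `a i` sum to one, this is at most twice their largest value. -/
theorem integral_blockNormSq_sub_sq_le {c : ℝ} (hc : ∀ i ∈ s, l i ≤ c) {i : κ} (hi : i ∈ s) :
    ∫ z, (blockNormSq l s z - 1) ^ 2 ∂stdPi κ ≤ 2 * c / blockWeight l s := by
  classical
  have hT := blockWeight_pos hl hi
  have hv := variance_eq_integral (μ := stdPi κ) (X := blockNormSq l s)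
    memLp_blockNormSq.1.aemeasurable
  rw [integral_blockNormSq hl hi] at hv
  rw [← hv]
  set a : κ → ℝ := fun i => if i ∈ s then l i / blockWeight l s else 0 with ha
  have hm : MemLp (fun t : ℝ => t ^ 2) 2 (gaussianReal 0 1) := by
    rw [memLp_two_iff_integrable_sq (by fun_prop)]
    exact (integrable_pow_gaussianReal 4).congr (ae_of_all _ fun t => by ring)
  have e : blockNormSq l s = ∑ i, fun z : κ → ℝ => a i * z i ^ 2 := by
    ext z
    simp only [Finset.sum_apply, ha, ite_mul, zero_mul, Finset.sum_ite_mem, Finset.univ_inter,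
      blockNormSq, Finset.sum_div]
    exact Finset.sum_congr rfl fun i _ => by ring
  have h2 := variance_sum_pi (μ := fun _ : κ => gaussianReal 0 1) (X := fun i t => a i * t ^ 2)
    (fun i => hm.const_mul (a i))
  rw [e, h2]
  have h3 : ∀ i, Var[fun t => a i * t ^ 2; gaussianReal 0 1] = 2 * a i ^ 2 := fun i => by
    rw [variance_const_mul, variance_sq_gaussianReal, mul_comm]
  simp_rw [h3, ha, ite_pow, mul_ite]
  simp only [ne_eq, OfNat.ofNat_ne_zero, not_false_eq_true, zero_pow, mul_zero, Finset.sum_ite_mem,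
    Finset.univ_inter]
  rw [le_div_iff₀ hT, Finset.sum_mul]
  calc ∑ i ∈ s, 2 * (l i / blockWeight l s) ^ 2 * blockWeight l s
      ≤ ∑ i ∈ s, 2 * c / blockWeight l s * l i := by
        refine Finset.sum_le_sum fun i hi => ?_
        have : 2 * (l i / blockWeight l s) ^ 2 * blockWeight l s =
          2 * l i / blockWeight l s * l i := by field_simp
        rw [this]
        have := hl i
        have := hc i hi
        gcongr
    _ = 2 * c := by
        rw [← Finset.mul_sum]
        change 2 * c / blockWeight l s * blockWeight l s = _
        field_simp

theorem sum_integral_blockMapDeriv_self_ge [DecidableEq κ] {c : ℝ} (hc0 : 0 < c)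
    (hc : ∀ i ∈ s, l i ≤ c) :
    blockWeight l s - c ≤ ∑ i ∈ s, l i * ∫ z, blockMapDeriv l s i i z ∂stdPi κ := by
  rcases s.eq_empty_or_nonempty with rfl | ⟨i₀, hi₀⟩
  · simp [blockWeight]; exact hc0.le
  have hI : ∀ i ∈ s, Integrable (blockMapDeriv l s i i) (stdPi κ) := fun i hi =>
    integrable_of_bounded_stdPi ((smoothBounded_blockMap hl hi).measurable' i)
      ((smoothBounded_blockMap hl hi).bounded' i)
  have hx := integrable_blockNormSq (l := l) (s := s)
  have h := integral_mono (μ := stdPi κ) ?_ ?_ (sum_blockMapDeriv_self_ge hl hc0.le hc)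
  · rw [integral_finsetSum _ fun i hi => (hI i hi).const_mul _] at h
    simp_rw [integral_const_mul] at h
    refine le_trans (le_of_eq ?_) h
    rw [integral_sub (by fun_prop) (integrable_const _), integral_const_mul,
      integral_sub (integrable_const _) (by fun_prop), integral_div,
      integral_sub hx (integrable_const _), integral_blockNormSq hl hi₀]
    simp
  · fun_prop
  · exact integrable_finsetSum _ fun i hi => (hI i hi).const_mul _

/-- The linear term averages to zero. The quadratic remainder gives `4 * c` by the variance bound,
and the rank-one part gives the other `2 * c`. -/
theorem sum_integral_blockMapDeriv_sq_le [DecidableEq κ] {c : ℝ} (hc0 : 0 < c)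
    (hc : ∀ i ∈ s, l i ≤ c) (hc' : ∀ i ∈ s, c ≤ 2 * l i) :
    ∑ i ∈ s, l i * ∑ j ∈ s, ∫ z, blockMapDeriv l s j i z ^ 2 ∂stdPi κ ≤
      blockWeight l s + 6 * c := by
  rcases s.eq_empty_or_nonempty with rfl | ⟨i₀, hi₀⟩
  · simp [blockWeight]; exact hc0.le
  have hI : ∀ i, ∀ j ∈ s, Integrable (fun z => blockMapDeriv l s j i z ^ 2) (stdPi κ) :=
    fun i j hj => by
      have := smoothBounded_blockMap hl hj
      refine integrable_of_bounded_stdPi ((this.measurable' i).pow_const 2) ?_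
      simp only [pow_two]
      exact exists_forall_abs_mul_le (this.bounded' i) (this.bounded' i)
  have hI' : ∀ i, Integrable (fun z => ∑ j ∈ s, blockMapDeriv l s j i z ^ 2) (stdPi κ) := fun i =>
    integrable_finsetSum _ fun j hj => hI i j hj
  have hx := integrable_blockNormSq (l := l) (s := s)
  have hx2 : Integrable (fun z => (blockNormSq l s z - 1) ^ 2) (stdPi κ) :=
    (memLp_blockNormSq.sub (memLp_const 1)).integrable_sq
  have h := integral_mono (μ := stdPi κ) ?_ ?_ (sum_blockMapDeriv_sq_le hl hc0 hc hc')
  · rw [integral_finsetSum _ fun i hi => (hI' i).const_mul _] at h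
    simp_rw [integral_const_mul] at h
    have e : ∀ i, ∫ z, ∑ j ∈ s, blockMapDeriv l s j i z ^ 2 ∂stdPi κ =
        ∑ j ∈ s, ∫ z, blockMapDeriv l s j i z ^ 2 ∂stdPi κ := fun i =>
      integral_finsetSum _ fun j hj => hI i j hj
    simp_rw [e] at h
    refine h.trans ?_
    rw [integral_add (by fun_prop) (integrable_const _), integral_const_mul,
      integral_add (by fun_prop) (by fun_prop), integral_sub (integrable_const _) (by fun_prop),
      integral_sub hx (integrable_const _), integral_blockNormSq hl hi₀, integral_const_mul]
    have hT := blockWeight_pos hl hi₀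
    have h4 := mul_le_mul_of_nonneg_left (integral_blockNormSq_sub_sq_le hl hc hi₀) hT.le
    rw [mul_div_cancel₀ _ hT.ne'] at h4
    simp
    linarith
  · exact integrable_finsetSum _ fun i hi => (hI' i).const_mul _
  · fun_prop

end Block

end

section

/-! ### Gluing the contractions over dyadic blocks -/

section Dyadic

variable {κ : Type*} {l : κ → ℝ}

theorem exists_dyadic_levels {Λ : ℝ} (hl : ∀ i, 0 < l i) (hΛ : ∀ i, l i ≤ Λ) :
    ∃ b : κ → ℕ, ∀ i, l i ≤ Λ * (1 / 2) ^ b i ∧ Λ * (1 / 2) ^ b i ≤ 2 * l i := by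
  have : ∀ i, ∃ n : ℕ, l i ≤ Λ * (1 / 2) ^ n ∧ Λ * (1 / 2) ^ n ≤ 2 * l i := by
    intro i
    have hΛ0 : 0 < Λ := (hl i).trans_le (hΛ i)
    obtain ⟨n, hn1, hn2⟩ := exists_nat_pow_near_of_lt_one (x := l i / Λ) (y := 1 / 2)
      (div_pos (hl i) hΛ0) ((div_le_one hΛ0).2 (hΛ i)) (by norm_num) (by norm_num)
    rw [lt_div_iff₀ hΛ0, pow_succ] at hn1
    rw [div_le_iff₀ hΛ0] at hn2
    exact ⟨n, by linarith, by linarith⟩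
  choose b hb using this
  exact ⟨b, hb⟩

variable [Fintype κ]

/-- The indices in the dyadic block number `n`. -/
def levelSet (b : κ → ℕ) (n : ℕ) : Finset κ := Finset.univ.filter fun i => b i = n

theorem mem_levelSet {b : κ → ℕ} {n : ℕ} {i : κ} : i ∈ levelSet b n ↔ b i = n := by
  simp [levelSet]

theorem sum_geometric_le (A : Finset ℕ) {Λ : ℝ} (hΛ : 0 ≤ Λ) :
    ∑ n ∈ A, Λ * (1 / 2 : ℝ) ^ n ≤ 2 * Λ := by
  rw [← Finset.mul_sum, mul_comm]
  refine mul_le_mul_of_nonneg_right ?_ hΛ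
  exact (summable_geometric_two.sum_le_tsum A fun n _ => by positivity).trans_eq
    tsum_geometric_two

theorem sum_eq_sum_levelSet (b : κ → ℕ) (f : κ → ℝ) :
    ∑ i, f i = ∑ n ∈ Finset.univ.image b, ∑ i ∈ levelSet b n, f i :=
  (Finset.sum_fiberwise_of_maps_to (fun i _ => Finset.mem_image_of_mem b (Finset.mem_univ i)) f).symm

variable [DecidableEq κ] in
/-- A smooth image of the standard Gaussian measure, concentrated on a weighted unit ball, which is
almost Gaussian when all weights are small. -/
theorem exists_almost_gaussian_map {Λ : ℝ} (hl : ∀ i, 0 < l i) (hΛ0 : 0 < Λ) (hΛ : ∀ i, l i ≤ Λ) :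
    ∃ (G : κ → (κ → ℝ) → ℝ) (G' : κ → κ → (κ → ℝ) → ℝ),
      (∀ i, SmoothBounded (G i) (G' i)) ∧
      (∀ z, ∑ i, l i * G i z ^ 2 ≤ ∑ i, l i) ∧
      ∑ i, l i - 2 * Λ ≤ ∑ i, l i * ∫ z, G' i i z ∂stdPi κ ∧
      ∑ i, l i * ∑ j, ∫ z, G' j i z ^ 2 ∂stdPi κ ≤ ∑ i, l i + 12 * Λ := by
  obtain ⟨b, hb⟩ := exists_dyadic_levels hl hΛ
  have hmem : ∀ {n i}, i ∈ levelSet b n → l i ≤ Λ * (1 / 2) ^ n ∧ Λ * (1 / 2) ^ n ≤ 2 * l i := by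
    intro n i hi
    obtain rfl := mem_levelSet.1 hi
    exact hb i
  have hc0 : ∀ n : ℕ, 0 < Λ * (1 / 2 : ℝ) ^ n := fun n => by positivity
  have hgeo := sum_geometric_le (Finset.univ.image b) hΛ0.le
  -- Each coordinate is contracted by the norm of its own block, so the Jacobian is block diagonal.
  -- The block costs `c` and `6 * c`, with `c = Λ * (1 / 2) ^ n`, sum to at most `2 * Λ` and `12 *
  -- Λ`.
  refine ⟨fun i => blockMap l (levelSet b (b i)) i, fun i => blockMapDeriv l (levelSet b (b i)) i,
    fun i => smoothBounded_blockMap hl (mem_levelSet.2 rfl), fun z => ?_, ?_, ?_⟩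
  · rw [sum_eq_sum_levelSet b l, sum_eq_sum_levelSet b]
    refine Finset.sum_le_sum fun n _ => le_trans (le_of_eq ?_) (sum_mul_blockMap_sq_le hl z)
    exact Finset.sum_congr rfl fun i hi => by simp only [mem_levelSet.1 hi]
  · rw [sum_eq_sum_levelSet b l, sum_eq_sum_levelSet b]
    have : ∑ n ∈ Finset.univ.image b, (blockWeight l (levelSet b n) - Λ * (1 / 2 : ℝ) ^ n) ≤
        ∑ n ∈ Finset.univ.image b, ∑ i ∈ levelSet b n,
          l i * ∫ z, blockMapDeriv l (levelSet b (b i)) i i z ∂stdPi κ := by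
      refine Finset.sum_le_sum fun n _ => (sum_integral_blockMapDeriv_self_ge hl (hc0 n)
        fun i hi => (hmem hi).1).trans (le_of_eq ?_)
      exact Finset.sum_congr rfl fun i hi => by rw [mem_levelSet.1 hi]
    rw [Finset.sum_sub_distrib] at this
    simp only [blockWeight] at this
    linarith
  · rw [sum_eq_sum_levelSet b l, sum_eq_sum_levelSet b]
    have : ∑ n ∈ Finset.univ.image b, ∑ i ∈ levelSet b n,
          l i * ∑ j, ∫ z, blockMapDeriv l (levelSet b (b j)) j i z ^ 2 ∂stdPi κ ≤
        ∑ n ∈ Finset.univ.image b, (blockWeight l (levelSet b n) + 6 * (Λ * (1 / 2 : ℝ) ^ n)) := by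
      refine Finset.sum_le_sum fun n _ => (le_of_eq ?_).trans
        (sum_integral_blockMapDeriv_sq_le hl (hc0 n) (fun i hi => (hmem hi).1)
          fun i hi => (hmem hi).2)
      refine Finset.sum_congr rfl fun i hi => ?_
      congr 1
      rw [← Finset.sum_subset (Finset.subset_univ (levelSet b n))]
      · exact Finset.sum_congr rfl fun j hj => by rw [mem_levelSet.1 hj]
      · intro j _ hj
        have : i ∉ levelSet b (b j) := fun h => by
          rw [mem_levelSet] at h hi hj
          exact hj (h ▸ hi)
        simp [blockMapDeriv, this]
    rw [Finset.sum_add_distrib, ← Finset.mul_sum] at this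
    simp only [blockWeight] at this
    linarith

end Dyadic

/-! ### Lower bound in the Gaussian sequence model -/

theorem SmoothBounded.const_mul {κ : Type*} {f : (κ → ℝ) → ℝ} {f' : κ → (κ → ℝ) → ℝ}
    (hf : SmoothBounded f f') (c : ℝ) :
    SmoothBounded (fun z => c * f z) (fun i z => c * f' i z) where
  measurable := hf.measurable.const_mul c
  measurable' i := (hf.measurable' i).const_mul c
  bounded := exists_forall_abs_mul_le (exists_forall_abs_const_le c) hf.bounded
  bounded' i := exists_forall_abs_mul_le (exists_forall_abs_const_le c) (hf.bounded' i)
  hasDerivAt i z := (hf.hasDerivAt i z).const_mul c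

/-- A minimax lower bound over a weighted ball in a Gaussian sequence model with repeated
observations along a line of directions. -/
theorem exists_least_favorable_map {κ : Type*} [Fintype κ] [DecidableEq κ] {l : κ → ℝ} {Λ : ℝ}
    (hl : ∀ i, 0 < l i) (hsum : ∑ i, l i = 1) (hΛ : ∀ i, l i ≤ Λ) (hΛ2 : 2 * Λ ≤ 1) :
    ∃ G : κ → (κ → ℝ) → ℝ, (∀ z, ∑ i, l i * G i z ^ 2 ≤ 1) ∧
      ∀ (K : Type) [Fintype K] (m : K → ℝ) (γ r : ℝ) (T : κ → (K × κ → ℝ) → ℝ),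
        0 ≤ r → (∀ i, Measurable (T i)) →
        (∀ z, ∫⁻ w, ENNReal.ofReal (∑ i, l i *
          (T i (w + fun e => m e.1 * G e.2 z) - γ * G i z) ^ 2) ∂stdPi (K × κ) ≤
            ENNReal.ofReal r) →
        γ ^ 2 * (1 - 2 * Λ) ^ 2 ≤ r * ((∑ k, m k ^ 2) * (1 + 12 * Λ) + 1) := by
  have hΛ0 : 0 < Λ := by
    obtain ⟨i, -, -⟩ := Finset.exists_ne_zero_of_sum_ne_zero (hsum.trans_ne one_ne_zero)
    exact (hl i).trans_le (hΛ i)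
  obtain ⟨G, G', hG, hG1, hG2, hG3⟩ := exists_almost_gaussian_map hl hΛ0 hΛ
  rw [hsum] at hG1 hG2 hG3
  refine ⟨G, hG1, fun K _ m γ r T hr hT hrisk => ?_⟩
  set H : K × κ → (κ → ℝ) → ℝ := fun e z => m e.1 * G e.2 z with hHdef
  have hH : ∀ e, SmoothBounded (H e) (fun i z => m e.1 * G' e.2 i z) := fun e =>
    (hG e.2).const_mul _
  have hGm := fun i => (hG i).measurable
  have hshift : Measurable fun p : (K × κ → ℝ) × (κ → ℝ) => p.1 + fun e => H e p.2 := by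
    have := fun e => (hH e).measurable
    fun_prop
  have hAm : ∀ i, Measurable fun p : (K × κ → ℝ) × (κ → ℝ) =>
      T i (p.1 + fun e => H e p.2) - γ * G i p.2 := fun i => by
    have := (hT i).comp hshift
    simp only [Function.comp_def] at this
    fun_prop
  -- The Bayes risk is an average of the pointwise risks, hence at most `r`. Its finiteness also
  -- supplies the square integrability needed for `vanTrees`, as each `l i` is positive.
  have htotal : ∫⁻ p : (K × κ → ℝ) × (κ → ℝ), ENNReal.ofReal (∑ i, l i *
      (T i (p.1 + fun e => H e p.2) - γ * G i p.2) ^ 2) ∂(stdPi (K × κ)).prod (stdPi κ) ≤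
        ENNReal.ofReal r := by
    rw [lintegral_prod_symm' _ (by fun_prop)]
    refine (lintegral_mono hrisk).trans ?_
    simp
  have hterm : ∀ p : (K × κ → ℝ) × (κ → ℝ), ∀ i,
      0 ≤ l i * (T i (p.1 + fun e => H e p.2) - γ * G i p.2) ^ 2 := fun p i =>
    mul_nonneg (hl i).le (sq_nonneg _)
  have hIs : Integrable (fun p : (K × κ → ℝ) × (κ → ℝ) => ∑ i, l i *
      (T i (p.1 + fun e => H e p.2) - γ * G i p.2) ^ 2) ((stdPi (K × κ)).prod (stdPi κ)) := by
    refine ⟨Measurable.aestronglyMeasurable (by fun_prop), ?_⟩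
    rw [hasFiniteIntegral_iff_ofReal
      (ae_of_all _ fun p => Finset.sum_nonneg fun i _ => hterm p i)]
    exact htotal.trans_lt ENNReal.ofReal_lt_top
  have hIi : ∀ i, Integrable (fun p : (K × κ → ℝ) × (κ → ℝ) => l i *
      (T i (p.1 + fun e => H e p.2) - γ * G i p.2) ^ 2)
        ((stdPi (K × κ)).prod (stdPi κ)) := fun i => by
    refine hIs.mono' (Measurable.aestronglyMeasurable (by fun_prop)) (ae_of_all _ fun p => ?_)
    rw [Real.norm_of_nonneg (hterm p i)]
    exact Finset.single_le_sum (f := fun i => l i *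
      (T i (p.1 + fun e => H e p.2) - γ * G i p.2) ^ 2) (fun i _ => hterm p i) (Finset.mem_univ i)
  have hL2 : ∀ i, MemLp (fun p : (K × κ → ℝ) × (κ → ℝ) =>
      T i (p.1 + fun e => H e p.2) - γ * G i p.2) 2 ((stdPi (K × κ)).prod (stdPi κ)) := fun i => by
    rw [memLp_two_iff_integrable_sq (hAm i).aestronglyMeasurable]
    refine ((hIi i).const_mul (l i)⁻¹).congr (ae_of_all _ fun p => ?_)
    simp only [inv_mul_cancel_left₀ (hl i).ne']
  have hle : ∑ i, l i * ∫ p : (K × κ → ℝ) × (κ → ℝ),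
      (T i (p.1 + fun e => H e p.2) - γ * G i p.2) ^ 2 ∂(stdPi (K × κ)).prod (stdPi κ) ≤ r := by
    simp_rw [← integral_const_mul]
    rw [← integral_finsetSum _ fun i _ => hIi i,
      integral_eq_lintegral_of_nonneg_ae
        (ae_of_all _ fun p => Finset.sum_nonneg fun i _ => hterm p i) hIs.1]
    exact ENNReal.toReal_le_of_le_ofReal hr htotal
  have key := vanTrees hH (fun i => (hG i).const_mul γ) hT (fun i => (hl i).le) hL2
  have e1 : ∑ i, l i * ∫ z, γ * G' i i z ∂stdPi κ = γ * ∑ i, l i * ∫ z, G' i i z ∂stdPi κ := by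
    simp_rw [integral_const_mul, Finset.mul_sum]
    exact Finset.sum_congr rfl fun i _ => by ring
  -- Every sample shifts the noise by a multiple of the same `G`, so the information factors. The
  -- prior information adds up to one because the weights do.
  have e2 : ∑ i, l i * (∑ e : K × κ, ∫ z, (m e.1 * G' e.2 i z) ^ 2 ∂stdPi κ + 1) =
      (∑ k, m k ^ 2) * (∑ i, l i * ∑ j, ∫ z, G' j i z ^ 2 ∂stdPi κ) + 1 := by
    simp_rw [mul_add, Finset.sum_add_distrib, mul_one, hsum, mul_pow, integral_const_mul,
      Fintype.sum_prod_type, ← Finset.mul_sum, ← Finset.sum_mul]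
    congr 1
    rw [Finset.mul_sum]
    exact Finset.sum_congr rfl fun i _ => by ring
  rw [e1, e2, mul_pow] at key
  have hm : 0 ≤ ∑ k, m k ^ 2 := Finset.sum_nonneg fun k _ => sq_nonneg _
  have h1 : γ ^ 2 * (1 - 2 * Λ) ^ 2 ≤ γ ^ 2 * (∑ i, l i * ∫ z, G' i i z ∂stdPi κ) ^ 2 :=
    mul_le_mul_of_nonneg_left (pow_le_pow_left₀ (by linarith) hG2 2) (sq_nonneg _)
  have h2 : 0 ≤ ∑ i, l i * ∑ j, ∫ z, G' j i z ^ 2 ∂stdPi κ :=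
    Finset.sum_nonneg fun i _ => mul_nonneg (hl i).le
      (Finset.sum_nonneg fun j _ => integral_nonneg fun z => sq_nonneg _)
  refine h1.trans (key.trans ?_)
  gcongr

end

section

open scoped RealInnerProductSpace Matrix

/-! ### The samples as affine images of a standard Gaussian vector -/

/-- Both sides are Gaussian with the same mean and covariance, so any factor `R` may be used, not
only the symmetric square root. The degenerate case `c = 0` is included. -/
theorem multivariateGaussian_eq_map {d : ℕ} (R : Matrix (Fin d) (Fin d) ℝ) (μ : Obs d) (c : ℝ) :
    multivariateGaussian μ (c ^ 2 • (R * Rᵀ)) =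
      (stdPi (Fin d)).map fun x => μ + c • WithLp.toLp 2 (R *ᵥ x) := by
  have hpsd : (c ^ 2 • (R * Rᵀ)).PosSemidef :=
    (Matrix.posSemidef_self_mul_conjTranspose R).smul (sq_nonneg c)
  set L : Obs d →L[ℝ] Obs d := Matrix.toEuclideanCLM (n := Fin d) (𝕜 := ℝ) (c • R) with hL
  have e : (fun x : Fin d → ℝ => μ + c • WithLp.toLp 2 (R *ᵥ x)) =
      ((fun x => μ + x) ∘ L) ∘ WithLp.toLp 2 := by
    ext x i
    simp [hL, Matrix.toEuclideanCLM_toLp]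
  rw [e, ← Measure.map_map (by fun_prop) (by fun_prop), map_pi_eq_stdGaussian,
    ← Measure.map_map (by fun_prop) (by fun_prop)]
  apply IsGaussian.ext
  · rw [Measure.map_map (by fun_prop) (by fun_prop)]
    simp only [id_eq, integral_id_multivariateGaussian]
    rw [integral_map (by fun_prop) (by fun_prop)]
    simp only [Function.comp_apply]
    rw [integral_add (integrable_const _) (L.integrable_comp IsGaussian.integrable_fun_id),
      integral_const, L.integral_comp_comm IsGaussian.integrable_fun_id]
    simp
  · ext x y
    rw [covarianceBilin_multivariateGaussian hpsd, covarianceBilin_map_const_add,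
      covarianceBilin_map IsGaussian.memLp_two_id, covarianceBilin_stdGaussian, innerSL_apply_apply,
      ContinuousLinearMap.adjoint_inner_left, ← ContinuousLinearMap.star_eq_adjoint, hL,
      ← map_star, ← ContinuousLinearMap.comp_apply, ← ContinuousLinearMap.mul_def, ← map_mul,
      Matrix.inner_toEuclideanCLM]
    congr 2
    ext i j
    simp [Matrix.star_eq_conjTranspose, pow_two, mul_assoc]

/-- The observations as a function of the standardized noise. -/
def observe {B d : ℕ} (N : Fin B → ℕ) (R : Matrix (Fin d) (Fin d) ℝ) (μ : Fin B → Obs d)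
    (c : Fin B → ℝ) (w : ((k : Fin B) × Fin (N k)) × Fin d → ℝ) : Samples B d N :=
  fun k j => μ k + c k • WithLp.toLp 2 (R *ᵥ fun i => w (⟨k, j⟩, i))

theorem sampleLaw_multivariateGaussian {B d : ℕ} (N : Fin B → ℕ) (R : Matrix (Fin d) (Fin d) ℝ)
    (μ : Fin B → Obs d) (c : Fin B → ℝ) :
    sampleLaw N (fun k => multivariateGaussian (μ k) (c k ^ 2 • (R * Rᵀ))) =
      (stdPi (((k : Fin B) × Fin (N k)) × Fin d)).map (observe N R μ c) := by
  set f : Fin B → (Fin d → ℝ) → Obs d := fun k x => μ k + c k • WithLp.toLp 2 (R *ᵥ x) with hf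
  have hfm : ∀ k, Measurable (f k) := fun k => by
    have : Continuous fun x : Fin d → ℝ => R *ᵥ x := by fun_prop
    have := this.measurable
    fun_prop
  have h1 : ∀ k, Measure.pi (fun _ : Fin (N k) => (stdPi (Fin d)).map (f k)) =
      (Measure.pi fun _ : Fin (N k) => stdPi (Fin d)).map fun x j => f k (x j) := fun k => by
    have : IsProbabilityMeasure ((stdPi (Fin d)).map (f k)) :=
      Measure.isProbabilityMeasure_map (hfm k).aemeasurable
    exact (Measure.pi_map_pi fun _ => (hfm k).aemeasurable).symm
  have h2 : (stdPi (((k : Fin B) × Fin (N k)) × Fin d)).map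
      (fun w (k : Fin B) (j : Fin (N k)) (i : Fin d) => w (⟨k, j⟩, i)) =
      Measure.pi fun k => Measure.pi fun _ : Fin (N k) => stdPi (Fin d) := by
    have a := Measure.infinitePi_map_curry
      (fun (_ : (k : Fin B) × Fin (N k)) (_ : Fin d) => gaussianReal 0 1)
    have b := Measure.infinitePi_map_piCurry
      (X := fun (k : Fin B) (_ : Fin (N k)) => Fin d → ℝ) (fun k _ => stdPi (Fin d))
    simp only [Measure.infinitePi_eq_pi] at a b
    rw [← b, ← a, Measure.map_map (by fun_prop) (by fun_prop)]
    rfl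
  unfold sampleLaw
  simp_rw [multivariateGaussian_eq_map]
  change Measure.pi (fun k => Measure.pi fun _ : Fin (N k) => (stdPi (Fin d)).map (f k)) = _
  simp_rw [h1]
  have hp : ∀ k, IsProbabilityMeasure ((Measure.pi fun _ : Fin (N k) => stdPi (Fin d)).map
      fun x j => f k (x j)) := fun k =>
    Measure.isProbabilityMeasure_map (Measurable.aemeasurable (by fun_prop))
  rw [← Measure.pi_map_pi (fun k => Measurable.aemeasurable (by fun_prop)), ← h2,
    Measure.map_map (by fun_prop) (by fun_prop)]
  rfl

end

section

open scoped Matrix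

/-- With this factor of `S`, passing to the eigenbasis and whitening gives a sequence model with
unit noise, in which the squared loss has weights `l i`. -/
theorem exists_spectral_decomposition {d : ℕ} {S : Matrix (Fin d) (Fin d) ℝ} (hS : S.PosDef) :
    ∃ (l : Fin d → ℝ) (U : Matrix (Fin d) (Fin d) ℝ), (∀ i, 0 < l i) ∧ ∑ i, l i = S.trace ∧
      (∀ i, l i ≤ ‖Matrix.toEuclideanCLM (n := Fin d) (𝕜 := ℝ) S‖) ∧ Uᵀ * U = 1 ∧
      S = (U * Matrix.diagonal fun i => √(l i)) * (U * Matrix.diagonal fun i => √(l i))ᵀ := by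
  have hH := hS.isHermitian
  have hpos := hS.eigenvalues_pos
  have hU := Unitary.coe_star_mul_self hH.eigenvectorUnitary
  refine ⟨hH.eigenvalues, hH.eigenvectorUnitary, hpos, ?_, fun i => ?_, ?_, ?_⟩
  · simpa using hH.trace_eq_sum_eigenvalues.symm
  · have h1 := hH.mulVec_eigenvectorBasis i
    set v := hH.eigenvectorBasis i with hv
    have hv1 : ‖v‖ = 1 := hH.eigenvectorBasis.orthonormal.1 i
    have h2 : Matrix.toEuclideanCLM (n := Fin d) (𝕜 := ℝ) S v = hH.eigenvalues i • v := by
      ext j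
      simpa using congrFun h1 j
    have h3 := (Matrix.toEuclideanCLM (n := Fin d) (𝕜 := ℝ) S).le_opNorm v
    rw [h2, norm_smul, hv1, mul_one, mul_one, Real.norm_of_nonneg (hpos i).le] at h3
    exact h3
  · simpa [Matrix.star_eq_conjTranspose] using hU
  · have h := hH.spectral_theorem
    rw [Matrix.transpose_mul, Matrix.diagonal_transpose, Matrix.mul_assoc,
      ← Matrix.mul_assoc (Matrix.diagonal _), Matrix.diagonal_mul_diagonal]
    simp_rw [Real.mul_self_sqrt (hpos _).le]
    conv_lhs => rw [h]
    simp [Unitary.conjStarAlgAut_apply, Matrix.star_eq_conjTranspose, Matrix.mul_assoc]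

section Model

variable {B d : ℕ} [NeZero B]

/-- The relative precision of the non-target tasks among the first `V`. -/
def auxPrecision (s2 : Fin B → ℝ) (V : ℕ) : ℝ := ∑ k ∈ (firstTasks B V).erase 0, s2 0 / s2 k

theorem zero_mem_firstTasks {V : ℕ} (hV : 1 ≤ V) : (0 : Fin B) ∈ firstTasks B V := by
  simp [firstTasks]; omega

theorem auxPrecision_nonneg {s2 : Fin B → ℝ} (hs : ∀ k, 0 ≤ s2 k) (V : ℕ) :
    0 ≤ auxPrecision s2 V := Finset.sum_nonneg fun k _ => div_nonneg (hs 0) (hs k)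

theorem oracleBound_relAggVar {s2 : Fin B → ℝ} (hs : ∀ k, 0 ≤ s2 k) {V : ℕ} (hV : 1 ≤ V)
    (hs0 : 0 < s2 0) {τ : ℝ} (hτ : 0 ≤ τ) :
    oracleBound τ (relAggVar s2 (firstTasks B V)) =
      (1 + auxPrecision s2 V * τ) / (1 + auxPrecision s2 V + auxPrecision s2 V * τ) := by
  have hh := auxPrecision_nonneg hs V
  have : relAggVar s2 (firstTasks B V) = 1 / (1 + auxPrecision s2 V) := by
    have e : s2 0 * ∑ k ∈ firstTasks B V, 1 / s2 k = 1 + auxPrecision s2 V := by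
      rw [← Finset.add_sum_erase _ _ (zero_mem_firstTasks hV), mul_add, mul_one_div_cancel hs0.ne',
        auxPrecision, Finset.mul_sum]
      simp_rw [mul_one_div]
    rw [relAggVar, aggVar, ← e]
    field_simp
  rw [this, oracleBound]
  set h := auxPrecision s2 V
  have h1 : 1 + τ * (1 - 1 / (1 + h)) = (1 + h + h * τ) / (1 + h) := by field_simp; ring
  rw [h1]
  have : 0 < 1 + h + h * τ := by positivity
  field_simp
  ring

omit [NeZero B] in
theorem measurable_observe (N : Fin B → ℕ) (R : Matrix (Fin d) (Fin d) ℝ) (μ : Fin B → Obs d)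
    (c : Fin B → ℝ) : Measurable (observe N R μ c) := by
  unfold observe
  have : Measurable fun x : Fin d → ℝ => R *ᵥ x := Continuous.measurable (by fun_prop)
  fun_prop

/-- The risk as an integral over the standardized noise. -/
theorem risk_eq_lintegral {N : Fin B → ℕ} {s2 : Fin B → ℝ} (hs : ∀ k, 0 ≤ s2 k)
    {S R : Matrix (Fin d) (Fin d) ℝ} (hR : S = R * Rᵀ) {P : Fin B → Measure (Obs d)}
    {μ : Fin B → Obs d} (hP : ∀ k, P k = multivariateGaussian (μ k) (((N k : ℝ) * s2 k) • S))
    {est : Samples B d N → Obs d} (hest : Measurable est) :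
    risk N P 0 est = ∫⁻ w, ENNReal.ofReal
      (‖est (observe N R μ (fun k => √(N k * s2 k)) w) - μ 0‖ ^ 2)
        ∂stdPi (((k : Fin B) × Fin (N k)) × Fin d) := by
  have hP' : P = fun k => multivariateGaussian (μ k) (√(N k * s2 k) ^ 2 • (R * Rᵀ)) := by
    ext1 k
    rw [hP k, Real.sq_sqrt (mul_nonneg (Nat.cast_nonneg _) (hs k)), hR]
  have hmean : taskMean (P 0) = μ 0 := by
    rw [taskMean, hP 0, integral_id_multivariateGaussian]
  rw [risk, hmean, hP', sampleLaw_multivariateGaussian N R μ fun k => √(N k * s2 k),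
    lintegral_map (by fun_prop) (measurable_observe N R μ _)]
  refine lintegral_congr fun w => ?_
  rw [← ofReal_norm, ENNReal.ofReal_pow (norm_nonneg _)]

/-! ### The upper bound -/

theorem lintegral_sum_affine_sq_stdPi {ι κ : Type*} [Fintype ι] [Fintype κ] (b : κ → ℝ)
    (q : κ → ι → ℝ) :
    ∫⁻ w, ENNReal.ofReal (∑ i, (b i + ∑ e, q i e * w e) ^ 2) ∂stdPi ι =
      ENNReal.ofReal (∑ i, b i ^ 2 + ∑ i, ∑ e, q i e ^ 2) := by
  have hI : ∀ i ∈ Finset.univ, Integrable (fun w : ι → ℝ => (b i + ∑ e, q i e * w e) ^ 2)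
      (stdPi ι) := fun i _ => (memLp_affine_stdPi (b i) (q i)).integrable_sq
  rw [← ofReal_integral_eq_lintegral_ofReal (integrable_finsetSum _ hI)
    (ae_of_all _ fun w => Finset.sum_nonneg fun i _ => sq_nonneg _), integral_finsetSum _ hI,
    Finset.sum_congr rfl fun i _ => integral_affine_sq_stdPi (b i) (q i), Finset.sum_add_distrib]

omit [NeZero B] in
theorem weighted_mean_observe_apply {N : Fin B → ℕ} (hN : ∀ k, 0 < N k)
    (R : Matrix (Fin d) (Fin d) ℝ) (μ : Fin B → Obs d) (a c : Fin B → ℝ)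
    (w : ((k : Fin B) × Fin (N k)) × Fin d → ℝ) (i : Fin d) :
    (∑ k, (a k / N k) • ∑ j, observe N R μ c w k j) i =
      (∑ k, a k • μ k) i + ∑ e, a e.1.1 / N e.1.1 * c e.1.1 * R i e.2 * w e := by
  have h1 : ∀ k, ((a k / N k) • ∑ j, observe N R μ c w k j) i = (a k • μ k) i +
      ∑ j : Fin (N k), ∑ l, a k / N k * c k * R i l * w (⟨k, j⟩, l) := by
    intro k
    have hk : (N k : ℝ) ≠ 0 := Nat.cast_ne_zero.2 (hN k).ne'
    have h2 : ∀ j, observe N R μ c w k j i = μ k i + c k * ∑ l, R i l * w (⟨k, j⟩, l) :=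
      fun j => rfl
    rw [PiLp.smul_apply, PiLp.smul_apply, WithLp.ofLp_sum, Finset.sum_apply, smul_eq_mul,
      smul_eq_mul, Finset.sum_congr rfl fun j _ => h2 j, Finset.sum_add_distrib, Finset.sum_const,
      Finset.card_univ, Fintype.card_fin, nsmul_eq_mul, mul_add]
    congr 1
    · field_simp
    · simp only [Finset.mul_sum]
      exact Finset.sum_congr rfl fun j _ => Finset.sum_congr rfl fun l _ => by ring
  rw [WithLp.ofLp_sum, WithLp.ofLp_sum, Finset.sum_apply, Finset.sum_apply,
    Finset.sum_congr rfl fun k _ => h1 k, Finset.sum_add_distrib]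
  congr 1
  rw [Fintype.sum_prod_type, Fintype.sum_sigma]

/-- The risk of a weighted average of the bag means. -/
theorem risk_weighted_mean {N : Fin B → ℕ} (hN : ∀ k, 0 < N k) {s2 : Fin B → ℝ}
    (hs : ∀ k, 0 ≤ s2 k) {S R : Matrix (Fin d) (Fin d) ℝ} (hR : S = R * Rᵀ)
    (htr : S.trace = 1) {P : Fin B → Measure (Obs d)} {μ : Fin B → Obs d}
    (hP : ∀ k, P k = multivariateGaussian (μ k) (((N k : ℝ) * s2 k) • S)) (a : Fin B → ℝ) :
    risk N P 0 (fun x => ∑ k, (a k / N k) • ∑ j, x k j) =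
      ENNReal.ofReal (‖∑ k, a k • μ k - μ 0‖ ^ 2 + ∑ k, a k ^ 2 * s2 k) := by
  rw [risk_eq_lintegral hs hR hP (by fun_prop)]
  set b : Obs d := ∑ k, a k • μ k - μ 0 with hb
  set q : Fin B → ℝ := fun k => a k / N k * √(N k * s2 k) with hq
  have hN' : ∀ k, (N k : ℝ) ≠ 0 := fun k => Nat.cast_ne_zero.2 (hN k).ne'
  have hform : ∀ w : ((k : Fin B) × Fin (N k)) × Fin d → ℝ,
      ‖∑ k, (a k / N k) • ∑ j, observe N R μ (fun k => √(N k * s2 k)) w k j - μ 0‖ ^ 2 =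
        ∑ i, (b i + ∑ e, q e.1.1 * R i e.2 * w e) ^ 2 := by
    intro w
    rw [EuclideanSpace.real_norm_sq_eq]
    refine Finset.sum_congr rfl fun i _ => ?_
    rw [PiLp.sub_apply, weighted_mean_observe_apply hN, hb, PiLp.sub_apply]
    ring
  simp_rw [hform]
  rw [lintegral_sum_affine_sq_stdPi b
      fun (i : Fin d) (e : ((k : Fin B) × Fin (N k)) × Fin d) => q e.1.1 * R i e.2,
    ← EuclideanSpace.real_norm_sq_eq]
  congr 2
  have htr' : ∑ i, ∑ j, R i j ^ 2 = 1 := by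
    rw [← htr, hR, Matrix.trace]
    simp [Matrix.mul_apply, pow_two]
  have hqk : ∀ k, (N k : ℝ) * q k ^ 2 = a k ^ 2 * s2 k := fun k => by
    have := hN' k
    simp only [hq, mul_pow, Real.sq_sqrt (mul_nonneg (Nat.cast_nonneg (N k)) (hs k))]
    field_simp
  have hrow : ∀ i : Fin d, ∑ e : ((k : Fin B) × Fin (N k)) × Fin d, (q e.1.1 * R i e.2) ^ 2 =
      (∑ k, a k ^ 2 * s2 k) * ∑ j, R i j ^ 2 := fun i => by
    have h1 : ∀ k, ∑ _j : Fin (N k), q k ^ 2 = a k ^ 2 * s2 k := fun k => by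
      rw [Finset.sum_const, Finset.card_univ, Fintype.card_fin, nsmul_eq_mul, hqk]
    rw [← Finset.sum_congr rfl fun k _ => h1 k, Fintype.sum_prod_type, Finset.sum_mul,
      Fintype.sum_sigma]
    refine Finset.sum_congr rfl fun k _ => ?_
    rw [Finset.sum_mul]
    refine Finset.sum_congr rfl fun j _ => ?_
    rw [Finset.mul_sum]
    exact Finset.sum_congr rfl fun l _ => mul_pow _ _ _
  rw [Finset.sum_congr rfl fun i _ => hrow i, ← Finset.mul_sum, htr', mul_one]

theorem minimaxRelRisk_le {N : Fin B → ℕ} (hN : ∀ k, 0 < N k) {s2 : Fin B → ℝ}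
    (hs : ∀ k, 0 ≤ s2 k) {V : ℕ} (hV : 1 ≤ V) (hsV : ∀ k ∈ firstTasks B V, 0 < s2 k) {τ : ℝ}
    (hτ : 0 ≤ τ) {S R : Matrix (Fin d) (Fin d) ℝ} (hR : S = R * Rᵀ) (htr : S.trace = 1) :
    minimaxRelRisk N s2 (singleClass N τ V S s2) ≤ ENNReal.ofReal
      ((1 + auxPrecision s2 V * τ) / (1 + auxPrecision s2 V + auxPrecision s2 V * τ)) := by
  have h0 := zero_mem_firstTasks (B := B) hV
  have hs0 := hsV 0 h0
  have hh := auxPrecision_nonneg hs V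
  set h := auxPrecision s2 V with hhdef
  -- This `β` minimizes the worst-case relative risk `(β * h) ^ 2 * τ + (1 - β * h) ^ 2 + β ^ 2 *
  -- h`.
  set β := 1 / (1 + h + h * τ) with hβ
  have hden : 0 < 1 + h + h * τ := by positivity
  have hβ0 : 0 < β := by positivity
  set a : Fin B → ℝ := fun k => if k = 0 then 1 - β * h else
    if k ∈ firstTasks B V then β * (s2 0 / s2 k) else 0 with ha
  have hsum : ∀ f : Fin B → ℝ, (∀ k ∉ firstTasks B V, f k = 0) →
      ∑ k, f k = f 0 + ∑ k ∈ (firstTasks B V).erase 0, f k := fun f hf => by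
    rw [Finset.add_sum_erase _ _ h0]
    exact (Finset.sum_subset (Finset.subset_univ _) fun k _ hk => hf k hk).symm
  have ha0 : a 0 = 1 - β * h := by simp [ha]
  have hak : ∀ k ∈ (firstTasks B V).erase 0, a k = β * (s2 0 / s2 k) := fun k hk => by
    rw [Finset.mem_erase] at hk
    simp [ha, hk.1, hk.2]
  have ha' : ∀ k ∉ firstTasks B V, a k = 0 := fun k hk => by
    have : k ≠ 0 := fun h => hk (h ▸ h0)
    simp [ha, this, hk]
  have hasum : ∑ k, a k = 1 := by
    rw [hsum a ha', ha0, Finset.sum_congr rfl hak, ← Finset.mul_sum, ← auxPrecision, ← hhdef]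
    ring
  have hvar : ∑ k, a k ^ 2 * s2 k = ((1 - β * h) ^ 2 + β ^ 2 * h) * s2 0 := by
    rw [hsum _ fun k hk => by rw [ha' k hk]; ring, ha0, add_mul]
    congr 1
    rw [hhdef, auxPrecision, Finset.mul_sum, Finset.sum_mul]
    refine Finset.sum_congr rfl fun k hk => ?_
    rw [hak k hk]
    have := (hsV k (Finset.mem_of_mem_erase hk)).ne'
    field_simp
  refine iInf₂_le_of_le (fun x => ∑ k, (a k / N k) • ∑ j, x k j) (by fun_prop)
    (iSup₂_le fun P hP => ?_)
  obtain ⟨μ, hPμ, hμ⟩ := hP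
  rw [risk_weighted_mean hN hs hR htr hPμ a, ← ENNReal.ofReal_div_of_pos hs0]
  refine ENNReal.ofReal_le_ofReal ((div_le_iff₀ hs0).2 ?_)
  -- The weights sum to one, so only the auxiliary tasks, of total weight `β * h`, contribute to the
  -- bias.
  have hbias : ‖∑ k, a k • μ k - μ 0‖ ≤ β * h * √(τ * s2 0) := by
    have e : ∑ k, a k • μ k - μ 0 = ∑ k, a k • (μ k - μ 0) := by
      simp_rw [smul_sub, Finset.sum_sub_distrib, ← Finset.sum_smul, hasum, one_smul]
    rw [e]
    refine (norm_sum_le _ _).trans ?_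
    rw [hsum _ fun k hk => by rw [ha' k hk]; simp]
    simp only [sub_self, smul_zero, norm_zero, zero_add]
    rw [hhdef, auxPrecision, Finset.mul_sum, Finset.sum_mul]
    refine Finset.sum_le_sum fun k hk => ?_
    have hk' := hsV k (Finset.mem_of_mem_erase hk)
    rw [hak k hk, norm_smul, Real.norm_of_nonneg (by positivity)]
    refine mul_le_mul_of_nonneg_left ?_ (by positivity)
    rw [norm_sub_rev]
    exact Real.le_sqrt_of_sq_le (hμ k (Finset.mem_of_mem_erase hk))
  have hbias2 : ‖∑ k, a k • μ k - μ 0‖ ^ 2 ≤ (β * h) ^ 2 * (τ * s2 0) := by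
    rw [← Real.sq_sqrt (mul_nonneg hτ hs0.le), ← mul_pow]
    exact pow_le_pow_left₀ (norm_nonneg _) hbias 2
  rw [hvar]
  have : (1 + h * τ) / (1 + h + h * τ) * s2 0 =
      (β * h) ^ 2 * (τ * s2 0) + ((1 - β * h) ^ 2 + β ^ 2 * h) * s2 0 := by
    rw [hβ]
    field_simp
    ring
  rw [this]
  linarith

end Model

end

section

open scoped Matrix

/-! ### The lower bound -/

section LowerBound

variable {B d : ℕ} [NeZero B]

-- Means in the range of `R` amount to a shift of the standardized noise, which is the form required
-- by the sequence model.
omit [NeZero B] in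
theorem observe_shift (N : Fin B → ℕ) (R : Matrix (Fin d) (Fin d) ℝ) (c m : Fin B → ℝ)
    (g : Fin d → ℝ) (w : ((k : Fin B) × Fin (N k)) × Fin d → ℝ) :
    observe N R (fun k => (c k * m k) • WithLp.toLp 2 (R *ᵥ g)) c w =
      observe N R 0 c (w + fun e => m e.1.1 * g e.2) := by
  funext k j
  have : (fun i => (w + fun e : ((k : Fin B) × Fin (N k)) × Fin d => m e.1.1 * g e.2) (⟨k, j⟩, i)) =
      (fun i => w (⟨k, j⟩, i)) + m k • g := rfl
  rw [observe, observe, this, Matrix.mulVec_add, Matrix.mulVec_smul, WithLp.toLp_add,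
    WithLp.toLp_smul, smul_add, smul_smul, Pi.zero_apply, zero_add, add_comm]

theorem norm_sq_eq_of_orthogonal {U : Matrix (Fin d) (Fin d) ℝ} (hU : Uᵀ * U = 1) (v : Obs d) :
    ‖v‖ ^ 2 = ∑ i, (Uᵀ *ᵥ v.ofLp) i ^ 2 := by
  have hU' : U * Uᵀ = 1 := mul_eq_one_comm.1 hU
  have h : (Uᵀ *ᵥ v.ofLp) ⬝ᵥ (Uᵀ *ᵥ v.ofLp) = v.ofLp ⬝ᵥ v.ofLp := by
    rw [Matrix.dotProduct_mulVec, Matrix.vecMul_transpose, Matrix.mulVec_mulVec, hU',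
      Matrix.one_mulVec]
  rw [EuclideanSpace.real_norm_sq_eq]
  simp only [dotProduct, ← pow_two] at h
  exact h.symm

theorem transpose_mulVec_diagonal {U : Matrix (Fin d) (Fin d) ℝ} (hU : Uᵀ * U = 1)
    (a g : Fin d → ℝ) (i : Fin d) :
    (Uᵀ *ᵥ ((U * Matrix.diagonal a) *ᵥ g)) i = a i * g i := by
  rw [Matrix.mulVec_mulVec, ← Matrix.mul_assoc, hU, Matrix.one_mul, Matrix.mulVec_diagonal]

/-- A lower bound for the risk of an estimator from the means `γ • u` for the target task and
`(γ + ρ) • u` for the other ones. -/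
theorem sq_mul_le_of_risk_le {N : Fin B → ℕ} (hN : ∀ k, 0 < N k) {s2 : Fin B → ℝ}
    (hs : ∀ k, 0 ≤ s2 k) {V : ℕ} (hV : 1 ≤ V) (hsV : ∀ k ∈ firstTasks B V, 0 < s2 k) {τ : ℝ}
    {S : Matrix (Fin d) (Fin d) ℝ} (hS : S.PosDef) (htr : S.trace = 1)
    {Λ : ℝ} (hΛ : ‖Matrix.toEuclideanCLM (n := Fin d) (𝕜 := ℝ) S‖ ≤ Λ) (hΛ2 : 2 * Λ ≤ 1)
    {est : Samples B d N → Obs d} (hest : Measurable est) {r : ℝ} (hr : 0 ≤ r)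
    (hrisk : ∀ P ∈ singleClass N τ V S s2, risk N P 0 est ≤ ENNReal.ofReal (s2 0 * r))
    (γ : ℝ) {ρ : ℝ} (hρ : ρ ^ 2 ≤ τ) :
    γ ^ 2 * (1 - 2 * Λ) ^ 2 ≤
      r * ((γ ^ 2 + auxPrecision s2 V * (γ + ρ) ^ 2) * (1 + 12 * Λ) + 1) := by
  obtain ⟨l, U, hl, hlsum, hlΛ, hU, hSU⟩ := exists_spectral_decomposition hS
  rw [htr] at hlsum
  set R := U * Matrix.diagonal fun i => √(l i) with hR
  obtain ⟨G, hG1, hG⟩ := exists_least_favorable_map hl hlsum (fun i => (hlΛ i).trans hΛ) hΛ2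
  have h0 := zero_mem_firstTasks (B := B) hV
  have hs0 := hsV 0 h0
  -- Tasks outside the first `V` get mean zero and carry no information. This also makes the
  -- quotient `m k` below harmless when `c k = 0`.
  set a : Fin B → ℝ := fun k => if k = 0 then γ else if k ∈ firstTasks B V then γ + ρ else 0 with ha
  have ha0 : a 0 = γ := by simp [ha]
  have ha1 : ∀ k ∈ (firstTasks B V).erase 0, a k = γ + ρ := fun k hk => by
    rw [Finset.mem_erase] at hk
    simp [ha, hk.1, hk.2]
  have ha2 : ∀ k ∉ firstTasks B V, a k = 0 := fun k hk => by
    have : k ≠ 0 := fun h => hk (h ▸ h0)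
    simp [ha, this, hk]
  set c : Fin B → ℝ := fun k => √(N k * s2 k) with hc
  set m : Fin B → ℝ := fun k => a k * √(s2 0) / c k with hm
  have hN' : ∀ k, (0 : ℝ) < N k := fun k => Nat.cast_pos.2 (hN k)
  have hcm : ∀ k, c k * m k = a k * √(s2 0) := by
    intro k
    by_cases hk : k ∈ firstTasks B V
    · exact mul_div_cancel₀ _ (Real.sqrt_pos.2 (mul_pos (hN' k) (hsV k hk))).ne'
    · simp [hm, ha2 k hk]
  -- The bag size cancels: each of the `N k` samples has variance factor `N k * s2 k`, so the bag
  -- contributes `a k ^ 2 * (s2 0 / s2 k)`.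
  have hJ : ∑ p : (k : Fin B) × Fin (N k), m p.1 ^ 2 =
      γ ^ 2 + auxPrecision s2 V * (γ + ρ) ^ 2 := by
    have h1 : ∀ k, ∑ _j : Fin (N k), m k ^ 2 = a k ^ 2 * (s2 0 / s2 k) := fun k => by
      rw [Finset.sum_const, Finset.card_univ, Fintype.card_fin, nsmul_eq_mul, hm]
      simp only [div_pow, mul_pow, hc, Real.sq_sqrt hs0.le,
        Real.sq_sqrt (mul_nonneg (hN' k).le (hs k))]
      have := (hN' k).ne'
      by_cases hk : s2 k = 0
      · simp [hk]
      · field_simp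
    rw [Fintype.sum_sigma, Finset.sum_congr rfl fun k _ => h1 k,
      ← Finset.sum_subset (Finset.subset_univ (firstTasks B V))
        fun k _ hk => by rw [ha2 k hk]; ring,
      ← Finset.add_sum_erase _ _ h0, ha0, div_self hs0.ne', mul_one, auxPrecision, Finset.sum_mul]
    congr 1
    exact Finset.sum_congr rfl fun k hk => by rw [ha1 k hk, mul_comm]
  -- The estimator in whitened eigencoordinates: its squared loss becomes `s2 0` times the
  -- `l`-weighted loss of the sequence model.
  set T : Fin d → (((k : Fin B) × Fin (N k)) × Fin d → ℝ) → ℝ := fun i w =>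
    (Uᵀ *ᵥ (est (observe N R 0 c w)).ofLp) i / (√(l i) * √(s2 0)) with hT
  have hTm : ∀ i, Measurable (T i) := fun i => by
    have h1 := hest.comp (measurable_observe N R 0 c)
    have h2 : Measurable fun v : Obs d => (Uᵀ *ᵥ v.ofLp) i := Continuous.measurable (by fun_prop)
    exact (h2.comp h1).div_const _
  rw [← hJ]
  refine hG _ _ γ r T hr hTm fun z => ?_
  set g : Fin d → ℝ := fun i => G i z with hg
  set μ : Fin B → Obs d := fun k => (c k * m k) • WithLp.toLp 2 (R *ᵥ g) with hμ
  have hnorm : ‖(WithLp.toLp 2 (R *ᵥ g) : Obs d)‖ ^ 2 ≤ 1 := by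
    rw [norm_sq_eq_of_orthogonal hU]
    simp only [hR, transpose_mulVec_diagonal hU, mul_pow, Real.sq_sqrt (hl _).le]
    exact hG1 z
  -- The class constrains only the differences of the means, which are `ρ * √(s2 0)` times a vector
  -- of the unit ball. Hence `γ` stays free and can be optimized.
  have hclass : (fun k => multivariateGaussian (μ k) (((N k : ℝ) * s2 k) • S)) ∈
      singleClass N τ V S s2 := by
    refine ⟨μ, fun k => rfl, fun k hk => ?_⟩
    have hτ : 0 ≤ τ := (sq_nonneg ρ).trans hρ
    by_cases hk0 : k = 0
    · subst hk0
      simpa using mul_nonneg hτ hs0.le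
    · have hak := ha1 k (Finset.mem_erase.2 ⟨hk0, hk⟩)
      simp only [hμ, hcm, ha0, hak]
      rw [← sub_smul, norm_smul, mul_pow, Real.norm_eq_abs, sq_abs,
        show (γ * √(s2 0) - (γ + ρ) * √(s2 0)) ^ 2 = ρ ^ 2 * √(s2 0) ^ 2 by ring,
        Real.sq_sqrt hs0.le]
      calc ρ ^ 2 * s2 0 * ‖(WithLp.toLp 2 (R *ᵥ g) : Obs d)‖ ^ 2 ≤ τ * s2 0 * 1 := by gcongr
        _ = τ * s2 0 := mul_one _
  have hle := hrisk _ hclass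
  rw [risk_eq_lintegral hs hSU (fun k => rfl) hest] at hle
  have hloss : ∀ w, ‖est (observe N R μ c w) - μ 0‖ ^ 2 =
      s2 0 * ∑ i, l i * (T i (w + fun e => m e.1.1 * G e.2 z) - γ * G i z) ^ 2 := by
    intro w
    rw [norm_sq_eq_of_orthogonal hU, Finset.mul_sum]
    refine Finset.sum_congr rfl fun i _ => ?_
    have h1 : (Uᵀ *ᵥ (μ 0).ofLp) i = √(s2 0) * (√(l i) * (γ * G i z)) := by
      simp only [hμ, hcm, ha0, WithLp.ofLp_smul, Matrix.mulVec_smul, Pi.smul_apply, hR,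
        transpose_mulVec_diagonal hU, smul_eq_mul, hg]
      ring
    have h2 : (Uᵀ *ᵥ (est (observe N R μ c w)).ofLp) i =
        √(s2 0) * (√(l i) * T i (w + fun e => m e.1.1 * G e.2 z)) := by
      have e1 := (Real.sqrt_pos.2 hs0).ne'
      have e2 := (Real.sqrt_pos.2 (hl i)).ne'
      simp only [hT]
      rw [← observe_shift N R c m g w, ← hμ]
      field_simp
    rw [WithLp.ofLp_sub, Matrix.mulVec_sub, Pi.sub_apply, h1, h2, ← mul_sub, ← mul_sub, mul_pow,
      mul_pow, Real.sq_sqrt hs0.le, Real.sq_sqrt (hl i).le]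
  change ∫⁻ w, ENNReal.ofReal (‖est (observe N R μ c w) - μ 0‖ ^ 2) ∂_ ≤ _ at hle
  simp_rw [hloss, ENNReal.ofReal_mul hs0.le] at hle
  rw [lintegral_const_mul' _ _ ENNReal.ofReal_ne_top] at hle
  exact (ENNReal.mul_le_mul_iff_right (ENNReal.ofReal_pos.2 hs0).ne' ENNReal.ofReal_ne_top).1 hle

/-- Optimization of the bound over the direction of the means. -/
theorem le_of_forall_sq_mul_le {h τ r A D : ℝ} (hh : 0 ≤ h) (hτ : 0 ≤ τ) (hr : 0 ≤ r) (hD : 1 ≤ D)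
    (H : ∀ γ : ℝ, γ ^ 2 * A ≤ r * ((γ ^ 2 + h * (γ + √τ) ^ 2) * D + 1)) :
    (1 + h * τ) / (1 + h + h * τ) * A ≤ r * D := by
  -- Substitution `y = 1 / γ`. The value `y = 0`, corresponding to infinite `γ`, is reached by
  -- continuity; it is the optimal one when `h * √τ = 0`.
  have H' : ∀ y : ℝ, A ≤ r * ((1 + h * (1 + √τ * y) ^ 2) * D + y ^ 2) := by
    have hclosed : IsClosed {y : ℝ | A ≤ r * ((1 + h * (1 + √τ * y) ^ 2) * D + y ^ 2)} :=
      isClosed_le (by fun_prop) (by fun_prop)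
    have hdense : Dense ({0}ᶜ : Set ℝ) := dense_compl_singleton 0
    have hsub : ({0}ᶜ : Set ℝ) ⊆ {y : ℝ | A ≤ r * ((1 + h * (1 + √τ * y) ^ 2) * D + y ^ 2)} := by
      intro y hy
      have hy' : y ≠ 0 := hy
      have h1 := mul_le_mul_of_nonneg_left (H y⁻¹) (sq_nonneg y)
      have e1 : y ^ 2 * (y⁻¹ ^ 2 * A) = A := by field_simp
      have e2 : y ^ 2 * (r * ((y⁻¹ ^ 2 + h * (y⁻¹ + √τ) ^ 2) * D + 1)) =
          r * ((1 + h * (1 + √τ * y) ^ 2) * D + y ^ 2) := by field_simp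
      rw [e1, e2] at h1
      exact h1
    exact fun y => hclosed.closure_subset_iff.2 hsub (hdense y)
  have hd1 : 0 < 1 + h * τ := by positivity
  have hd2 : 0 < 1 + h + h * τ := by positivity
  -- The minimizer of `1 + h * (1 + √τ * y) ^ 2 + y ^ 2`, with minimum `(1 + h + h * τ) / (1 + h *
  -- τ)`. The factor `D ≥ 1` is then also put on the term `y ^ 2`.
  have h1 := H' (-(h * √τ) / (1 + h * τ))
  have h2 : (1 + h * (1 + √τ * (-(h * √τ) / (1 + h * τ))) ^ 2) * D +
      (-(h * √τ) / (1 + h * τ)) ^ 2 ≤ (1 + h + h * τ) / (1 + h * τ) * D := by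
    have hsq : √τ ^ 2 = τ := Real.sq_sqrt hτ
    have e1 : √τ * (-(h * √τ) / (1 + h * τ)) = -(h * τ) / (1 + h * τ) := by
      rw [← mul_div_assoc]; congr 1; linear_combination (-h) * hsq
    have e2 : (-(h * √τ) / (1 + h * τ)) ^ 2 = h ^ 2 * τ / (1 + h * τ) ^ 2 := by
      rw [div_pow]; congr 1; linear_combination (h ^ 2) * hsq
    rw [e1, e2]
    have e3 : (1 + h * (1 + -(h * τ) / (1 + h * τ)) ^ 2) * D + h ^ 2 * τ / (1 + h * τ) ^ 2 * D =
        (1 + h + h * τ) / (1 + h * τ) * D := by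
      field_simp
      ring
    have e4 : 0 ≤ h ^ 2 * τ / (1 + h * τ) ^ 2 := by positivity
    nlinarith
  have h3 := h1.trans (mul_le_mul_of_nonneg_left h2 hr)
  calc (1 + h * τ) / (1 + h + h * τ) * A
      ≤ (1 + h * τ) / (1 + h + h * τ) * (r * ((1 + h + h * τ) / (1 + h * τ) * D)) := by gcongr
    _ = r * D := by field_simp

theorem le_minimaxRelRisk {N : Fin B → ℕ} (hN : ∀ k, 0 < N k) {s2 : Fin B → ℝ}
    (hs : ∀ k, 0 ≤ s2 k) {V : ℕ} (hV : 1 ≤ V) (hsV : ∀ k ∈ firstTasks B V, 0 < s2 k) {τ : ℝ}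
    (hτ : 0 ≤ τ) {S : Matrix (Fin d) (Fin d) ℝ} (hS : S.PosDef) (htr : S.trace = 1) :
    ENNReal.ofReal ((1 + auxPrecision s2 V * τ) / (1 + auxPrecision s2 V + auxPrecision s2 V * τ) -
        16 * ‖Matrix.toEuclideanCLM (n := Fin d) (𝕜 := ℝ) S‖) ≤
      minimaxRelRisk N s2 (singleClass N τ V S s2) := by
  have hs0 := hsV 0 (zero_mem_firstTasks hV)
  have hh := auxPrecision_nonneg hs V
  set h := auxPrecision s2 V
  set Λ := ‖Matrix.toEuclideanCLM (n := Fin d) (𝕜 := ℝ) S‖ with hΛ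
  have hΛ0 : 0 ≤ Λ := norm_nonneg _
  set b := (1 + h * τ) / (1 + h + h * τ) with hb
  have hb0 : 0 ≤ b := by positivity
  have hb1 : b ≤ 1 := by
    rw [hb, div_le_one (by positivity)]
    linarith
  refine le_iInf₂ fun est hest => ?_
  set v := ⨆ P ∈ singleClass N τ V S s2, risk N P 0 est / ENNReal.ofReal (s2 0) with hv
  by_cases hvtop : v = ⊤
  · rw [hvtop]; exact le_top
  refine ENNReal.ofReal_le_of_le_toReal ?_
  have hr : 0 ≤ v.toReal := ENNReal.toReal_nonneg
  -- For `Λ > 1 / 2` the claimed lower bound is negative, because `b ≤ 1`.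
  rcases lt_or_ge 1 (2 * Λ) with hΛ2 | hΛ2
  · linarith
  have hrisk : ∀ P ∈ singleClass N τ V S s2,
      risk N P 0 est ≤ ENNReal.ofReal (s2 0 * v.toReal) := fun P hP => by
    rw [ENNReal.ofReal_mul hs0.le, ENNReal.ofReal_toReal hvtop, mul_comm,
      ← ENNReal.div_le_iff (ENNReal.ofReal_pos.2 hs0).ne' ENNReal.ofReal_ne_top]
    exact le_iSup₂ (f := fun P _ => risk N P 0 est / ENNReal.ofReal (s2 0)) P hP
  have key := le_of_forall_sq_mul_le (A := (1 - 2 * Λ) ^ 2) (D := 1 + 12 * Λ) hh hτ hr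
    (by linarith) fun γ => sq_mul_le_of_risk_le hN hs hV hsV hS htr hΛ.ge hΛ2 hest hr hrisk γ
      (Real.sq_sqrt hτ).le
  rw [← hb] at key
  by_contra! hlt
  -- The constant is `16 = 4 + 12`: the first-order losses are `4 * Λ` from `(1 - 2 * Λ) ^ 2` and
  -- `12 * Λ` from the information factor, and `b ≤ 1`.
  have h1 : v.toReal * (1 + 12 * Λ) < (b - 16 * Λ) * (1 + 12 * Λ) :=
    mul_lt_mul_of_pos_right hlt (by linarith)
  have h2 : 0 ≤ b * Λ ^ 2 := by positivity
  nlinarith [mul_le_mul_of_nonneg_right hb1 hΛ0]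

end LowerBound

end

end

end MultiTask

theorem mainTheorem5 :
    ∃ ε : ℝ → ℝ,
      (ε =O[Filter.atTop] fun t : ℝ => Real.log t / t) ∧
      ∀ (B : ℕ) [NeZero B] (V : ℕ) (_ : 1 ≤ V) (_ : V ≤ B)
        (N : Fin B → ℕ) (_ : ∀ k, 0 < N k)
        (s2 : Fin B → ℝ) (_ : ∀ k, 0 ≤ s2 k) (_ : ∀ k ∈ MultiTask.firstTasks B V, 0 < s2 k)
        (τ : ℝ) (_ : 0 ≤ τ)
        (d : ℕ) (S : Matrix (Fin d) (Fin d) ℝ) (_ : S.PosDef) (_ : S.trace = 1),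
        ENNReal.ofReal
            (MultiTask.oracleBound τ (MultiTask.relAggVar s2 (MultiTask.firstTasks B V))
              - ε (MultiTask.effDim S))
          ≤ MultiTask.minimaxRelRisk N s2 (MultiTask.singleClass N τ V S s2) ∧
        MultiTask.minimaxRelRisk N s2 (MultiTask.singleClass N τ V S s2)
          ≤ ENNReal.ofReal
            (MultiTask.oracleBound τ (MultiTask.relAggVar s2 (MultiTask.firstTasks B V))) := by
  -- Since the trace is one, `16 / effDim S` is `16 * Λ`. The logarithm is not needed: `1 ≤ log t`
  -- once `t ≥ exp 1`.
  refine ⟨fun t => 16 / t, ?_, ?_⟩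
  · refine Asymptotics.IsBigO.of_bound 16 ?_
    filter_upwards [Filter.eventually_ge_atTop (Real.exp 1)] with t ht
    have ht0 : 0 < t := (Real.exp_pos 1).trans_le ht
    have hlog : 1 ≤ Real.log t := (Real.le_log_iff_exp_le ht0).2 ht
    rw [Real.norm_of_nonneg (by positivity), Real.norm_of_nonneg (by positivity), ← mul_div_assoc]
    gcongr
    linarith
  · intro B _ V hV _ N hN s2 hs hsV τ hτ d S hS htr
    have hs0 := hsV 0 (MultiTask.zero_mem_firstTasks hV)
    rw [MultiTask.oracleBound_relAggVar hs hV hs0 hτ, MultiTask.effDim, htr]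
    simp only [div_div_eq_mul_div, div_one]
    obtain ⟨l, U, -, -, -, -, hR⟩ := MultiTask.exists_spectral_decomposition hS
    exact ⟨MultiTask.le_minimaxRelRisk hN hs hV hsV hτ hS htr,
      MultiTask.minimaxRelRisk_le hN hs hV hsV hτ hR htr⟩
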